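/- **Theorem (generalized canonical typicality, exponential bounds).** Let $\mathcal H_a$ and $\mathcal H_b$ be complex Hilbert spaces with $\mathcal H_a$ of finite dimension $d_a$ and $\mathcal H_b$ separable, and let $\rho$ be a density matrix (a positive operator with $\mathrm{tr}\,\rho=1$) on $\mathcal H=\mathcal H_a\otimes\mathcal H_b$. Write $\rho=\sum_n p_n|n\rangle\langle n|$ with an orthonormal eigenbasis $(|n\rangle)_n$; let $Z_n$ be independent complex Gaussian random variables with mean $0$ and $\mathbb E|Z_n|^2=p_n$ (real and imaginary parts independent, each of variance $p_n/2$), let $\mathrm G(\rho)$ be the law of $\sum_n Z_n|n\rangle$, let $\mathrm{GA}(\rho)(d\psi)=\|\psi\|^2\,\mathrm G(\rho)(d\psi)$, and let $\mathrm{GAP}(\rho)$ be the law of $\psi/\|\psi\|$ for $\psi\sim\mathrm{GA}(\rho)$, a measure on the unit sphere $\mathbb S(\mathcal H)$ with its Borel $\sigma$-algebra. For $\psi\in\mathbb S(\mathcal H)$ let $\rho_a^\psi=\mathrm{tr}_b|\psi\rangle\langle\psi|$, where $\mathrm{tr}_b$ is the partial trace over $\mathcal H_b$; let $\|M\|_{\mathrm{tr}}=\mathrm{tr}\sqrt{M^*M}$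 be the trace norm and $\|\rho\|$ the operator norm. Then $\mathrm{GAP}(\rho)$ is a probability measure and, for every $\delta>0$, $$\mathrm{GAP}(\rho)\Bigl\{\psi\in\mathbb S(\mathcal H):\ \bigl\|\rho_a^\psi-\mathrm{tr}_b\rho\bigr\|_{\mathrm{tr}}\le 48\pi\, d_a\sqrt{\ln\!\Bigl(\frac{12d_a^2}{\delta}\Bigr)\|\rho\|}\Bigr\}\ \ge\ 1-\delta$$ (for $\delta\ge1$ this is trivial; the square root of a negative number is read as $0$). Equivalently, for every $\varepsilon\ge0$, $$\mathrm{GAP}(\rho)\Bigl\{\psi\in\mathbb S(\mathcal H):\ \bigl\|\rho_a^\psi-\mathrm{tr}_b\rho\bigr\|_{\mathrm{tr}}>\varepsilon\Bigr\}\ \le\ 12\,d_a^2\exp\Bigl(-\frac{\tilde C\varepsilon^2}{d_a^2\|\rho\|}\Bigr),\qquad \tilde C=\frac1{2304\pi^2}.$$ -/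

import Mathlib

open MeasureTheory ProbabilityTheory
open scoped TensorProduct NNReal ENNReal

noncomputable section

namespace GAPTypicality

universe u v

section Hilbert

variable (H : Type u) [NormedAddCommGroup H] [InnerProductSpace ℂ H]

/-- A density matrix on `H`: a positive operator of trace `1`. (For a positive operator, the trace
`∑ i, ⟪b i, ρ (b i)⟫` does not depend on the orthonormal basis `b`.) -/
structure DensityMatrix where
  op : H →L[ℂ] H
  isPositive : op.IsPositive
  hasSum_trace : ∀ (s : Set H) (b : HilbertBasis s ℂ H), HasSum (fun i => inner ℂ (b i) (op (b i))) 1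

variable {H} [CompleteSpace H]

/-- A positive operator of finite trace is compact. -/
theorem DensityMatrix.isCompactOperator (ρ : DensityMatrix H) : IsCompactOperator ρ.op := by
  obtain ⟨w, b, -⟩ := exists_hilbertBasis ℂ H
  have hnn : (0 : H →L[ℂ] H) ≤ ρ.op :=
    (ContinuousLinearMap.nonneg_iff_isPositive ρ.op).2 ρ.isPositive
  set S : H →L[ℂ] H := CFC.sqrt ρ.op with hS
  have hSS : S * S = ρ.op := CFC.sqrt_mul_sqrt_self ρ.op hnn
  have hSpos : S.IsPositive :=
    (ContinuousLinearMap.nonneg_iff_isPositive S).1 (CFC.sqrt_nonneg ρ.op)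
  have hsym : ∀ x y : H, inner ℂ (S x) y = inner ℂ x (S y) := hSpos.inner_left_eq_inner_right
  have hsum : Summable (fun i => ‖S (b i)‖ ^ 2) := by
    have h := Complex.hasSum_re (ρ.hasSum_trace w b)
    refine h.summable.congr fun i => ?_
    rw [← hSS, show (S * S) (b i) = S (S (b i)) from rfl, ← hsym, inner_self_eq_norm_sq_to_K]
    norm_cast
  suffices hc : IsCompactOperator S by
    rw [← hSS]
    exact hc.clm_comp S
  let T : Finset w → (H →L[ℂ] H) := fun F => ∑ i ∈ F, InnerProductSpace.rankOne ℂ (b i) (S (b i))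
  have hT : ∀ F, IsCompactOperator (T F) := by
    intro F
    show T F ∈ compactOperator (RingHom.id ℂ) H H
    refine Submodule.sum_mem _ fun i _ => ?_
    show IsCompactOperator _
    exact (isCompactOperator_of_locallyCompactSpace_rng
      (ContinuousLinearMap.toSpanSingleton ℂ (b i))).comp_clm (innerSL ℂ (S (b i)))
  have hbound : ∀ F, ‖T F - S‖ ≤ √(∑' i : {i // i ∉ F}, ‖S (b i)‖ ^ 2) := by
    intro F
    refine ContinuousLinearMap.opNorm_le_bound _ (Real.sqrt_nonneg _) fun x => ?_
    have hpars := Complex.hasSum_re (b.hasSum_inner_mul_inner ((T F - S) x) ((T F - S) x))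
    have hcoef : ∀ i, (inner ℂ ((T F - S) x) (b i) * inner ℂ (b i) ((T F - S) x)).re
        ≤ (Set.indicator {i | i ∉ F} (fun i => ‖S (b i)‖ ^ 2) i) * ‖x‖ ^ 2 := by
      classical
      intro i
      have h1 : inner ℂ (b i) ((T F - S) x) = if i ∈ F then 0 else -inner ℂ (S (b i)) x := by
        simp only [T, sub_apply, sum_apply, InnerProductSpace.rankOne_apply,
          inner_sub_right, inner_sum, inner_smul_right, orthonormal_iff_ite.1 b.orthonormal, hsym]
        split_ifs with h <;> simp [h]
      have h2 : (inner ℂ ((T F - S) x) (b i) * inner ℂ (b i) ((T F - S) x)).re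
          = ‖inner ℂ (b i) ((T F - S) x)‖ ^ 2 := by
        rw [← inner_conj_symm ((T F - S) x) (b i), ← Complex.normSq_eq_conj_mul_self,
          Complex.ofReal_re, Complex.normSq_eq_norm_sq]
      rw [h2, h1]
      by_cases h : i ∈ F
      · simp [h]
      · simp only [h, if_false, norm_neg, Set.indicator, Set.mem_ofPred_eq, not_false_eq_true,
          if_true, ← mul_pow]
        gcongr
        exact norm_inner_le_norm _ _
    have hind : HasSum (Set.indicator {i | i ∉ F} (fun i => ‖S (b i)‖ ^ 2))
        (∑' i : {i // i ∉ F}, ‖S (b i)‖ ^ 2) :=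
      hasSum_subtype_iff_indicator.1 (hsum.subtype {i | i ∉ F}).hasSum
    have hle := hasSum_le hcoef hpars (hind.mul_right (‖x‖ ^ 2))
    rw [inner_self_eq_norm_sq_to_K] at hle
    have hle' : ‖(T F - S) x‖ ^ 2 ≤ (∑' i : {i // i ∉ F}, ‖S (b i)‖ ^ 2) * ‖x‖ ^ 2 := by
      refine le_trans (le_of_eq ?_) hle
      norm_cast
    have := Real.sqrt_le_sqrt hle'
    rwa [Real.sqrt_sq (norm_nonneg _), Real.sqrt_mul' _ (by positivity),
      Real.sqrt_sq (norm_nonneg _)] at this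
  refine isCompactOperator_of_tendsto (l := Filter.atTop) (F := T) ?_ (Filter.Eventually.of_forall hT)
  rw [tendsto_iff_norm_sub_tendsto_zero]
  refine squeeze_zero (fun _ => norm_nonneg _) hbound ?_
  have := (tendsto_tsum_compl_atTop_zero (fun i => ‖S (b i)‖ ^ 2)).sqrt
  simpa using this

open scoped ComplexOrder in
/-- Spectral theorem: a density matrix has an orthonormal eigenbasis, with eigenvalues `≥ 0`. -/
theorem DensityMatrix.exists_eigenbasis (ρ : DensityMatrix H) :
    ∃ (s : Set H) (b : HilbertBasis s ℂ H) (p : s → ℝ≥0),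
      ∀ n, ρ.op (b n) = ((p n : ℝ) : ℂ) • b n := by
  have hsymm : (ρ.op : H →ₗ[ℂ] H).IsSymmetric := ρ.isPositive.isSymmetric
  let E : ℂ → Submodule ℂ H := fun μ => Module.End.eigenspace (ρ.op : Module.End ℂ H) μ
  have hE : ∀ μ x, x ∈ E μ ↔ ρ.op x = μ • x := fun μ x => Module.End.mem_eigenspace_iff
  have hclosed : ∀ μ, IsClosed (E μ : Set H) := by
    intro μ
    have : (E μ : Set H) = {x | ρ.op x = μ • x} := by
      ext x
      exact hE μ x
    rw [this]
    exact isClosed_eq ρ.op.continuous (continuous_const_smul μ)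
  have : ∀ μ, CompleteSpace (E μ) := fun μ => (hclosed μ).completeSpace_coe
  choose w e _he using fun μ => exists_hilbertBasis ℂ (E μ)
  let v : (Σ μ : ℂ, w μ) → H := fun a => (e a.1 a.2 : H)
  have hv : Orthonormal ℂ v :=
    (LinearMap.IsSymmetric.orthogonalFamily_eigenspaces hsymm).orthonormal_sigma_orthonormal
      (fun μ => (e μ).orthonormal)
  have hbot : (Submodule.span ℂ (Set.range v))ᗮ = ⊥ := by
    rw [eq_bot_iff, ← ContinuousLinearMap.orthogonalComplement_iSup_eigenspaces_eq_bot
      ρ.isCompactOperator ρ.isPositive.isSymmetric]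
    intro x hx
    rw [← Submodule.iInf_orthogonal, Submodule.mem_iInf]
    intro μ
    rw [Submodule.mem_orthogonal]
    intro y hy
    have hsum := ((e μ).hasSum_repr ⟨y, hy⟩).mapL (E μ).subtypeL
    have hz := hsum.mapL (innerSL ℂ x)
    have h0 : ∀ i, innerSL ℂ x ((E μ).subtypeL ((e μ).repr ⟨y, hy⟩ i • e μ i)) = 0 := by
      intro i
      have : inner ℂ x (v ⟨μ, i⟩) = 0 :=
        Submodule.inner_left_of_mem_orthogonal (Submodule.subset_span (Set.mem_range_self _)) hx
      simp only [map_smul, innerSL_apply_apply, Submodule.subtypeL_apply, smul_eq_mul]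
      exact mul_eq_zero_of_right _ this
    simp only [h0] at hz
    have : inner ℂ x y = 0 := hz.unique hasSum_zero
    exact inner_eq_zero_symm.1 this
  have hbot' : (Submodule.span ℂ (Set.range ((↑) : Set.range v → H)))ᗮ = ⊥ := by
    rwa [Subtype.range_coe]
  have hev : ∀ n : Set.range v, ∃ p : ℝ≥0, ρ.op n = ((p : ℝ) : ℂ) • (n : H) := by
    rintro ⟨_, ⟨⟨μ, i⟩, rfl⟩⟩
    have h1 : ρ.op (v ⟨μ, i⟩) = μ • v ⟨μ, i⟩ := (hE μ _).1 (e μ i).2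
    have h2 := ρ.isPositive.inner_nonneg_right (v ⟨μ, i⟩)
    rw [h1, inner_smul_right, inner_self_eq_norm_sq_to_K, hv.1] at h2
    simp only [Complex.coe_algebraMap, Complex.ofReal_one, one_pow, mul_one] at h2
    obtain ⟨h4, h5⟩ := Complex.le_def.1 h2
    refine ⟨⟨μ.re, h4⟩, ?_⟩
    rw [h1]
    congr 1
    apply Complex.ext
    · rfl
    · exact h5.symm
  choose p hp using hev
  refine ⟨Set.range v, HilbertBasis.mkOfOrthogonalEqBot hv.toSubtypeRange hbot', p, fun n => ?_⟩
  rw [HilbertBasis.coe_mkOfOrthogonalEqBot]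
  exact hp n

/-- The index set of the eigenbasis `eigenbasis ρ`. -/
def DensityMatrix.eigenIndex (ρ : DensityMatrix H) : Set H := ρ.exists_eigenbasis.choose

/-- An orthonormal basis of eigenvectors `|n⟩` of `ρ`. -/
def DensityMatrix.eigenbasis (ρ : DensityMatrix H) : HilbertBasis ρ.eigenIndex ℂ H :=
  ρ.exists_eigenbasis.choose_spec.choose

/-- The eigenvalues `p n` of `ρ`, so that `ρ = ∑ n, p n |n⟩⟨n|`. -/
def DensityMatrix.eigenvalue (ρ : DensityMatrix H) : ρ.eigenIndex → ℝ≥0 :=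
  ρ.exists_eigenbasis.choose_spec.choose_spec.choose

theorem DensityMatrix.op_eigenbasis (ρ : DensityMatrix H) (n : ρ.eigenIndex) :
    ρ.op (ρ.eigenbasis n) = ((ρ.eigenvalue n : ℝ) : ℂ) • ρ.eigenbasis n :=
  ρ.exists_eigenbasis.choose_spec.choose_spec.choose_spec n

/-- The law of a complex Gaussian variable with mean `0` and variance `p`: the real and imaginary
parts are independent real Gaussians with mean `0` and variance `p / 2`. -/
def complexGaussian (p : ℝ≥0) : Measure ℂ :=
  ((gaussianReal 0 (p / 2)).prod (gaussianReal 0 (p / 2))).map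
    (fun x : ℝ × ℝ => (⟨x.1, x.2⟩ : ℂ))

variable [MeasurableSpace H]

/-- `G(ρ)`: the law of `∑ n, Z n • |n⟩` with independent complex Gaussians `Z n` with mean `0` and
variance `p n`. -/
def gaussianMeasure (ρ : DensityMatrix H) : Measure H :=
  (Measure.infinitePi fun n => complexGaussian (ρ.eigenvalue n)).map
    (fun z : ρ.eigenIndex → ℂ => ∑' n, z n • ρ.eigenbasis n)

/-- `GA(ρ)`: the measure with density `‖ψ‖ ^ 2` relative to `G(ρ)`. -/
def gaussianAdjusted (ρ : DensityMatrix H) : Measure H :=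
  (gaussianMeasure ρ).withDensity (fun ψ => ENNReal.ofReal (‖ψ‖ ^ 2))

/-- `GAP(ρ)`: the law of `ψ / ‖ψ‖` for `ψ` distributed according to `GA(ρ)`, as a measure on the
unit sphere. (`GA(ρ)` gives no mass to `0`, so that the law of `ψ / ‖ψ‖` lives on the sphere.) -/
def GAP (ρ : DensityMatrix H) : Measure (Metric.sphere (0 : H) 1) :=
  ((gaussianAdjusted ρ).map (fun ψ => ((‖ψ‖⁻¹ : ℝ) : ℂ) • ψ)).comap Subtype.val

end Hilbert

section Bipartite

variable {Ha : Type u} {Hb : Type v}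
  [NormedAddCommGroup Ha] [InnerProductSpace ℂ Ha] [FiniteDimensional ℂ Ha]
  [NormedAddCommGroup Hb] [InnerProductSpace ℂ Hb] [CompleteSpace Hb]

/-- Since `Ha` is finite-dimensional, the algebraic tensor product `Ha ⊗ Hb` with its canonical
inner product is complete, i.e. it is the Hilbert space tensor product. -/
instance instCompleteSpaceTensor : CompleteSpace (Ha ⊗[ℂ] Hb) := by
  let e := stdOrthonormalBasis ℂ Ha
  let n := Module.finrank ℂ Ha
  let f : (Ha ⊗[ℂ] Hb) →L[ℂ] (Fin n → Hb) := ContinuousLinearMap.pi fun i =>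
    (TensorProduct.lidIsometry ℂ Hb).toContinuousLinearEquiv.toContinuousLinearMap ∘L
      (ContinuousLinearMap.rTensor Hb (innerSL ℂ (e i)))
  let g : (Fin n → Hb) →L[ℂ] (Ha ⊗[ℂ] Hb) :=
    ∑ i, (TensorProduct.mkL ℂ Ha Hb (e i)) ∘L (ContinuousLinearMap.proj i)
  have hgf : Function.LeftInverse g f := by
    intro x
    induction x using TensorProduct.induction_on with
    | zero => simp
    | add x y hx hy => rw [map_add, map_add, hx, hy]
    | tmul x y =>
      have : g (f (x ⊗ₜ[ℂ] y)) = (∑ i, inner ℂ (e i) x • e i) ⊗ₜ[ℂ] y := by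
        simp only [f, g, TensorProduct.sum_tmul]
        simp [TensorProduct.smul_tmul]
      rw [this, e.sum_repr' x]
  have hfg : Function.RightInverse g f := by
    intro y
    funext i
    simp [f, g, orthonormal_iff_ite.1 e.orthonormal]
  let E : (Ha ⊗[ℂ] Hb) ≃L[ℂ] (Fin n → Hb) := ContinuousLinearEquiv.equivOfInverse f g hgf hfg
  exact E.isUniformEmbedding.isUniformInducing.completeSpace (by
    rw [E.surjective.range_eq]
    exact isComplete_univ)

/-- For `m : Hb`, the operator `φ ↦ φ ⊗ m` from `Ha` to `Ha ⊗ Hb`; its adjoint is the partial inner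
product with `m`. -/
def tensorRight (m : Hb) : Ha →L[ℂ] (Ha ⊗[ℂ] Hb) := (TensorProduct.mkL ℂ Ha Hb).flip m

/-- The partial trace `tr_b M = ∑ m, ⟨m|_b M |m⟩_b` over an orthonormal basis `m` of `Hb`, for a
trace-class operator `M`; the operator on `Ha` does not depend on the choice of the basis.
(The set chosen here is an orthonormal basis, its elements being the basis vectors.) -/
def partialTrace (M : (Ha ⊗[ℂ] Hb) →L[ℂ] (Ha ⊗[ℂ] Hb)) : Ha →L[ℂ] Ha :=
  ∑' m : (exists_hilbertBasis ℂ Hb).choose,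
    (ContinuousLinearMap.adjoint (tensorRight (m : Hb))) ∘L M ∘L (tensorRight (m : Hb))

/-- The reduced density matrix `tr_b |ψ⟩⟨ψ|`. -/
def reducedDensity (ψ : Ha ⊗[ℂ] Hb) : Ha →L[ℂ] Ha :=
  partialTrace (InnerProductSpace.rankOne ℂ ψ ψ)

/-- The trace norm `tr |M| = tr √(M* M)`. -/
def traceNorm (M : Ha →L[ℂ] Ha) : ℝ :=
  haveI : CompleteSpace Ha := FiniteDimensional.complete ℂ Ha
  (LinearMap.trace ℂ Ha (CFC.sqrt (star M * M) : Ha →L[ℂ] Ha)).re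

end Bipartite

end GAPTypicality

end

open GAPTypicality MeasureTheory
open scoped TensorProduct

/-!
Under the Gaussian measure `G(ρ)`, diagonalising a quadratic form makes `⟨ψ|D|ψ⟩` a weighted sum of
independent `|z|²`, so `𝔼 exp ⟨ψ|D|ψ⟩ ≤ exp (tr (ρ D) + 2 ‖ρ‖ ‖D‖²)` as soon as `‖ρ‖ ‖D‖ ≤ 1/2`.
On the event `⟨ψ|D|ψ⟩ ≥ 0`, which depends only on the direction of `ψ`, the density of `GA(ρ)`
satisfies `‖ψ‖² ≤ exp (⟨ψ|D + 1|ψ⟩ - 1)`. Taking `D = t (T - tr (ρ T) - s)` and optimising over `t`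
gives sub-Gaussian tails of `⟨ψ|T|ψ⟩` under `GAP(ρ)`, directly on the sphere and without a
concentration inequality for Lipschitz functions.

Since `tr (A ρ_a^ψ) = ⟨ψ|A ⊗ 1|ψ⟩`, this controls the `d_a²` numbers `tr (W M)` for
`M = ρ_a^ψ - tr_b ρ` and `W` running over the discrete Weyl operators. By Parseval for the discrete
Fourier transform they determine the Hilbert-Schmidt norm of `M`, which bounds the trace norm. The
four directions `1, -1, i, -i` in `ℂ` and the factor `3` of the tail bound give `12 d_a²`.
-/

namespace GAPTypicality

open ProbabilityTheory
open scoped NNReal ENNReal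

section ComplexGaussian

lemma inv_one_sub_le_exp {x : ℝ} (hx : x ≤ 1 / 2) : (1 - x)⁻¹ ≤ Real.exp (x + 2 * x ^ 2) := by
  have hpos : 0 < 1 - x := by linarith
  rw [← Real.log_le_iff_le_exp (inv_pos.2 hpos), Real.log_inv]
  have hlog := Real.one_sub_inv_le_log_of_pos hpos
  have hinv : (1 - x)⁻¹ - 1 ≤ x + 2 * x ^ 2 := by
    rw [inv_eq_one_div, sub_le_iff_le_add, div_le_iff₀ hpos]
    nlinarith [mul_nonneg (sq_nonneg x) (sub_nonneg.2 hx)]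
  linarith

lemma lintegral_sq_gaussianReal (v : ℝ≥0) :
    ∫⁻ x, ENNReal.ofReal (x ^ 2) ∂(gaussianReal 0 v) = v := by
  have hvar := variance_fun_id_gaussianReal (μ := 0) (v := v)
  rw [variance_eq_integral (by fun_prop)] at hvar
  simp only [integral_id_gaussianReal, sub_zero] at hvar
  have hint : Integrable (fun x : ℝ => x ^ 2) (gaussianReal 0 v) :=
    (memLp_id_gaussianReal 2).integrable_sq
  rw [← ofReal_integral_eq_lintegral_ofReal hint (ae_of_all _ fun x => sq_nonneg x), hvar,
    ENNReal.ofReal_coe_nnreal]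

lemma lintegral_exp_mul_sq_gaussianReal {v : ℝ≥0} {c : ℝ} (hc : 2 * v * c < 1) :
    ∫⁻ x, ENNReal.ofReal (Real.exp (c * x ^ 2)) ∂(gaussianReal 0 v) =
      ENNReal.ofReal (√(1 - 2 * v * c))⁻¹ := by
  rcases eq_or_ne v 0 with rfl | hv
  · simp
  have : (0 : ℝ) < v := by positivity
  have hb : 0 < (1 - 2 * v * c) / (2 * v) := div_pos (by linarith) (by positivity)
  rw [gaussianReal_of_var_ne_zero _ hv,
    lintegral_withDensity_eq_lintegral_mul _ (measurable_gaussianPDF _ _) (by fun_prop)]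
  have hdensity (x : ℝ) : (gaussianPDF 0 v * fun x => ENNReal.ofReal (Real.exp (c * x ^ 2))) x =
      ENNReal.ofReal ((√(2 * Real.pi * v))⁻¹ *
        Real.exp (-((1 - 2 * v * c) / (2 * v)) * x ^ 2)) := by
    rw [Pi.mul_apply, gaussianPDF, ← ENNReal.ofReal_mul (gaussianPDFReal_nonneg _ _ _),
      gaussianPDFReal, mul_assoc, ← Real.exp_add]
    congr 3
    field_simp
    ring
  simp_rw [hdensity]
  rw [← ofReal_integral_eq_lintegral_ofReal ((integrable_exp_neg_mul_sq hb).const_mul _)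
    (ae_of_all _ fun x => by positivity), integral_const_mul, integral_gaussian,
    ← Real.sqrt_inv, ← Real.sqrt_inv, ← Real.sqrt_mul (by positivity)]
  congr 2
  field_simp

lemma measurable_complex_mk : Measurable fun x : ℝ × ℝ => (⟨x.1, x.2⟩ : ℂ) :=
  Complex.measurableEquivRealProd.symm.measurable

instance (p : ℝ≥0) : IsProbabilityMeasure (complexGaussian p) :=
  Measure.isProbabilityMeasure_map measurable_complex_mk.aemeasurable

lemma lintegral_norm_sq_complexGaussian (p : ℝ≥0) :
    ∫⁻ z, ENNReal.ofReal (‖z‖ ^ 2) ∂(complexGaussian p) = p := by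
  rw [complexGaussian, lintegral_map (by fun_prop) measurable_complex_mk]
  have hsplit (x : ℝ × ℝ) : ENNReal.ofReal (‖(⟨x.1, x.2⟩ : ℂ)‖ ^ 2) =
      ENNReal.ofReal (x.1 ^ 2) + ENNReal.ofReal (x.2 ^ 2) := by
    rw [← ENNReal.ofReal_add (sq_nonneg _) (sq_nonneg _), Complex.sq_norm, Complex.normSq_mk,
      sq, sq]
  simp_rw [hsplit]
  rw [lintegral_add_left (by fun_prop),
    measurePreserving_fst.lintegral_comp (f := fun x => ENNReal.ofReal (x ^ 2)) (by fun_prop),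
    measurePreserving_snd.lintegral_comp (f := fun x => ENNReal.ofReal (x ^ 2)) (by fun_prop),
    lintegral_sq_gaussianReal, ← ENNReal.coe_add, add_halves]

lemma lintegral_exp_mul_norm_sq_complexGaussian {p : ℝ≥0} {c : ℝ} (hc : p * c < 1) :
    ∫⁻ z, ENNReal.ofReal (Real.exp (c * ‖z‖ ^ 2)) ∂(complexGaussian p) =
      ENNReal.ofReal (1 - p * c)⁻¹ := by
  rw [complexGaussian, lintegral_map (by fun_prop) measurable_complex_mk]
  have hsplit (x : ℝ × ℝ) : ENNReal.ofReal (Real.exp (c * ‖(⟨x.1, x.2⟩ : ℂ)‖ ^ 2)) =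
      ENNReal.ofReal (Real.exp (c * x.1 ^ 2)) * ENNReal.ofReal (Real.exp (c * x.2 ^ 2)) := by
    rw [← ENNReal.ofReal_mul (Real.exp_pos _).le, ← Real.exp_add, Complex.sq_norm,
      Complex.normSq_mk]
    ring_nf
  have hvar : 2 * ((p / 2 : ℝ≥0) : ℝ) * c = p * c := by push_cast; ring
  simp_rw [hsplit]
  rw [lintegral_prod_mul (f := fun x => ENNReal.ofReal (Real.exp (c * x ^ 2)))
    (g := fun x => ENNReal.ofReal (Real.exp (c * x ^ 2))) (by fun_prop) (by fun_prop),
    lintegral_exp_mul_sq_gaussianReal (hvar.trans_lt hc), hvar,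
    ← ENNReal.ofReal_mul (by positivity), ← mul_inv, Real.mul_self_sqrt (by linarith)]

lemma charFun_complexGaussian (p : ℝ≥0) (t : ℂ) :
    charFun (complexGaussian p) t = Complex.exp (-(p : ℂ) * ‖t‖ ^ 2 / 4) := by
  rw [charFun_apply, complexGaussian,
    integral_map measurable_complex_mk.aemeasurable (by fun_prop)]
  have hsplit (x : ℝ × ℝ) : Complex.exp ((inner ℝ (⟨x.1, x.2⟩ : ℂ) t : ℝ) * Complex.I) =
      Complex.exp (t.re * x.1 * Complex.I) * Complex.exp (t.im * x.2 * Complex.I) := by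
    rw [← Complex.exp_add]
    congr 1
    simp [Complex.inner]
    ring
  simp_rw [hsplit]
  rw [integral_prod_mul (f := fun x : ℝ => Complex.exp (t.re * x * Complex.I))
    (g := fun x : ℝ => Complex.exp (t.im * x * Complex.I)), ← charFun_apply_real,
    ← charFun_apply_real, charFun_gaussianReal, charFun_gaussianReal, ← Complex.exp_add]
  congr 1
  rw [← Complex.ofReal_pow ‖t‖, Complex.sq_norm, Complex.normSq_apply]
  push_cast
  ring

lemma map_mul_complexGaussian (c : ℂ) (p : ℝ≥0) :
    (complexGaussian p).map (fun z => c * z) = complexGaussian (‖c‖₊ ^ 2 * p) := by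
  have : IsProbabilityMeasure ((complexGaussian p).map fun z => c * z) :=
    Measure.isProbabilityMeasure_map (by fun_prop)
  refine Measure.ext_of_charFun (funext fun t => ?_)
  have hinner (z : ℂ) : inner ℝ (c * z) t = inner ℝ z (starRingEnd ℂ c * t) := by
    simp [Complex.inner, mul_comm, mul_left_comm]
  have hmap : charFun ((complexGaussian p).map fun z => c * z) t =
      charFun (complexGaussian p) (starRingEnd ℂ c * t) := by
    rw [charFun_apply, charFun_apply, integral_map (by fun_prop) (by fun_prop)]
    simp_rw [hinner]
  rw [hmap, charFun_complexGaussian, charFun_complexGaussian, norm_mul, RCLike.norm_conj]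
  push_cast
  ring_nf

variable {F : Type*} [Fintype F]

lemma map_toLp_pi_complexGaussian :
    (Measure.pi fun _ : F => complexGaussian 2).map (WithLp.toLp 2) =
      stdGaussian (EuclideanSpace ℂ F) := by
  have : IsProbabilityMeasure ((Measure.pi fun _ : F => complexGaussian 2).map (WithLp.toLp 2)) :=
    Measure.isProbabilityMeasure_map (by fun_prop)
  refine Measure.ext_of_charFun (E := EuclideanSpace ℂ F) (funext fun t => ?_)
  rw [charFun_pi, charFun_stdGaussian]
  simp_rw [charFun_complexGaussian, ← Complex.exp_sum]
  congr 1
  rw [← Complex.ofReal_pow, PiLp.norm_sq_eq_of_L2]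
  push_cast
  rw [← Finset.sum_div, neg_div, ← Finset.mul_sum]
  ring

lemma stdGaussian_eq_map_sum_smul {G : Type*} [Fintype G]
    (w : OrthonormalBasis G ℂ (EuclideanSpace ℂ F)) :
    stdGaussian (EuclideanSpace ℂ F) =
      (Measure.pi fun _ : G => complexGaussian 2).map fun z => ∑ i, z i • w i := by
  let e : EuclideanSpace ℂ G ≃ₗᵢ[ℝ] EuclideanSpace ℂ F :=
    { w.repr.symm.toLinearEquiv.restrictScalars ℝ with norm_map' := w.repr.symm.norm_map }
  have he : Measurable e := e.continuous.measurable
  rw [← stdGaussian_map e, ← map_toLp_pi_complexGaussian, Measure.map_map he (by fun_prop)]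
  congr with z
  simp [e, w.sum_repr_symm]

lemma pi_complexGaussian_eq_map_stdGaussian (p : F → ℝ≥0) :
    Measure.pi (fun n => complexGaussian (p n)) =
      (stdGaussian (EuclideanSpace ℂ F)).map fun x n => ((√(p n / 2) : ℝ) : ℂ) * x n := by
  have hscale (n : F) : (complexGaussian 2).map (fun z => ((√(p n / 2) : ℝ) : ℂ) * z) =
      complexGaussian (p n) := by
    rw [map_mul_complexGaussian]
    congr 1
    ext
    push_cast
    rw [Complex.norm_real, Real.norm_of_nonneg (Real.sqrt_nonneg _), Real.sq_sqrt (by positivity),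
      div_mul_cancel₀ _ two_ne_zero]
  have (n : F) : IsProbabilityMeasure
      ((complexGaussian 2).map fun z => ((√(p n / 2) : ℝ) : ℂ) * z) :=
    Measure.isProbabilityMeasure_map (by fun_prop)
  rw [← map_toLp_pi_complexGaussian, Measure.map_map (by fun_prop) (by fun_prop)]
  simp_rw [← hscale]
  exact (Measure.pi_map_pi (fun n => by fun_prop)).symm

end ComplexGaussian

section QuadraticForm

variable {F : Type*} [Fintype F]

lemma lintegral_exp_sum_mul_norm_sq_le {c : F → ℝ} (hc : ∀ n, c n ≤ 1 / 4) :
    ∫⁻ z, ENNReal.ofReal (Real.exp (∑ n, c n * ‖z n‖ ^ 2))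
        ∂(Measure.pi fun _ : F => complexGaussian 2) ≤
      ENNReal.ofReal (Real.exp (2 * ∑ n, c n + 8 * ∑ n, c n ^ 2)) := by
  have hfactor (n : F) : ∫⁻ z, ENNReal.ofReal (Real.exp (c n * ‖z n‖ ^ 2))
      ∂(Measure.pi fun _ : F => complexGaussian 2) ≤
        ENNReal.ofReal (Real.exp (2 * c n + 8 * c n ^ 2)) := by
    rw [(measurePreserving_eval (fun _ => complexGaussian 2) n).lintegral_comp
      (f := fun z => ENNReal.ofReal (Real.exp (c n * ‖z‖ ^ 2))) (by fun_prop),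
      lintegral_exp_mul_norm_sq_complexGaussian
        (by rw [NNReal.coe_ofNat]; linarith [hc n]), NNReal.coe_ofNat]
    refine ENNReal.ofReal_le_ofReal ((inv_one_sub_le_exp (by linarith [hc n])).trans_eq ?_)
    ring_nf
  simp_rw [Real.exp_sum, ENNReal.ofReal_prod_of_nonneg fun _ _ => (Real.exp_pos _).le]
  rw [lintegral_prod_eq_prod_lintegral_of_indepFun Finset.univ
    (fun n (z : F → ℂ) => ENNReal.ofReal (Real.exp (c n * ‖z n‖ ^ 2)))
    (iIndepFun_pi (μ := fun _ => complexGaussian 2)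
      (X := fun n z => ENNReal.ofReal (Real.exp (c n * ‖z‖ ^ 2))) fun n => by fun_prop)
    (fun n => by fun_prop)]
  refine (Finset.prod_le_prod' fun n _ => hfactor n).trans_eq ?_
  rw [← ENNReal.ofReal_prod_of_nonneg fun _ _ => (Real.exp_pos _).le, ← Real.exp_sum,
    Finset.sum_add_distrib, Finset.mul_sum, Finset.mul_sum]

lemma lintegral_exp_inner_stdGaussian_le
    {A : EuclideanSpace ℂ F →ₗ[ℂ] EuclideanSpace ℂ F} (hA : A.IsSymmetric)
    (hA' : ∀ x, (inner ℂ x (A x)).re ≤ 1 / 4 * ‖x‖ ^ 2) :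
    ∫⁻ x, ENNReal.ofReal (Real.exp (inner ℂ x (A x)).re) ∂(stdGaussian (EuclideanSpace ℂ F)) ≤
      ENNReal.ofReal (Real.exp
        (2 * (A.trace ℂ _).re + 8 * ((A ∘ₗ A).trace ℂ _).re)) := by
  set w := hA.eigenvectorBasis rfl
  set c := hA.eigenvalues rfl
  have hw (i) : A (w i) = (c i : ℂ) • w i := hA.apply_eigenvectorBasis rfl i
  have hc (i) : c i ≤ 1 / 4 := by
    have h := hA' (w i)
    rwa [hw, inner_smul_right, inner_self_eq_norm_sq_to_K, w.norm_eq_one, RCLike.ofReal_one,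
      one_pow, mul_one, Complex.ofReal_re, one_pow, mul_one] at h
  have hquad (z : Fin (Module.finrank ℂ (EuclideanSpace ℂ F)) → ℂ) :
      (inner ℂ (∑ i, z i • w i) (A (∑ i, z i • w i))).re = ∑ i, c i * ‖z i‖ ^ 2 := by
    simp_rw [map_sum, map_smul, hw, smul_smul]
    rw [w.orthonormal.inner_sum, Complex.re_sum]
    refine Finset.sum_congr rfl fun i _ => ?_
    rw [← mul_assoc, ← Complex.normSq_eq_conj_mul_self, ← Complex.ofReal_mul, Complex.ofReal_re,
      Complex.normSq_eq_norm_sq, mul_comm]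
  have htrace : (A.trace ℂ _).re = ∑ i, c i := by
    simp [LinearMap.trace_eq_sum_inner A w, hw, inner_smul_right_eq_smul]
  have htrace_sq : ((A ∘ₗ A).trace ℂ _).re = ∑ i, c i ^ 2 := by
    simp [LinearMap.trace_eq_sum_inner (A ∘ₗ A) w, hw, inner_smul_right_eq_smul, sq]
  have hA_cont : Continuous A := A.continuous_of_finiteDimensional
  rw [stdGaussian_eq_map_sum_smul w, lintegral_map (by fun_prop) (by fun_prop), htrace, htrace_sq]
  simp_rw [hquad]
  exact lintegral_exp_sum_mul_norm_sq_le hc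

variable {H : Type*} [NormedAddCommGroup H] [InnerProductSpace ℂ H] [CompleteSpace H]

lemma lintegral_exp_inner_map_stdGaussian_le (L : EuclideanSpace ℂ F →L[ℂ] H) {D : H →L[ℂ] H}
    (hD : IsSelfAdjoint D) (hLD : ‖L‖ ^ 2 * ‖D‖ ≤ 1 / 4)
    (b : OrthonormalBasis F ℂ (EuclideanSpace ℂ F)) :
    ∫⁻ x, ENNReal.ofReal (Real.exp (inner ℂ (L x) (D (L x))).re)
        ∂(stdGaussian (EuclideanSpace ℂ F)) ≤
      ENNReal.ofReal (Real.exp (2 * ∑ n, (inner ℂ (L (b n)) (D (L (b n)))).re +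
        8 * (‖L‖ ^ 2 * ‖D‖ ^ 2 * ∑ n, ‖L (b n)‖ ^ 2))) := by
  let A : EuclideanSpace ℂ F →L[ℂ] EuclideanSpace ℂ F := L.adjoint ∘L D ∘L L
  have hA : IsSelfAdjoint A := hD.adjoint_conj L
  have hinner (x) : inner ℂ x (A x) = inner ℂ (L x) (D (L x)) := L.adjoint_inner_right _ _
  have hbound (x) : (inner ℂ x (A x)).re ≤ 1 / 4 * ‖x‖ ^ 2 := by
    rw [hinner]
    calc (inner ℂ (L x) (D (L x))).re ≤ ‖L x‖ * ‖D (L x)‖ := re_inner_le_norm (𝕜 := ℂ) _ _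
      _ ≤ ‖L x‖ * (‖D‖ * ‖L x‖) := by gcongr; exact D.le_opNorm _
      _ = ‖D‖ * ‖L x‖ ^ 2 := by ring
      _ ≤ ‖D‖ * (‖L‖ * ‖x‖) ^ 2 := by gcongr; exact L.le_opNorm _
      _ = ‖L‖ ^ 2 * ‖D‖ * ‖x‖ ^ 2 := by ring
      _ ≤ 1 / 4 * ‖x‖ ^ 2 := by gcongr
  have hnorm (x) : ‖A x‖ ^ 2 ≤ ‖L‖ ^ 2 * ‖D‖ ^ 2 * ‖L x‖ ^ 2 := by
    rw [← mul_pow, ← mul_pow, mul_assoc]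
    gcongr
    calc ‖A x‖ ≤ ‖L.adjoint‖ * ‖D (L x)‖ := L.adjoint.le_opNorm _
      _ ≤ ‖L‖ * (‖D‖ * ‖L x‖) := by
        rw [LinearIsometryEquiv.norm_map]
        gcongr
        exact D.le_opNorm _
  have htrace : (LinearMap.trace ℂ _ A.toLinearMap).re =
      ∑ n, (inner ℂ (L (b n)) (D (L (b n)))).re := by
    simp [LinearMap.trace_eq_sum_inner _ b, hinner]
  have htrace_sq : (LinearMap.trace ℂ _ (A.toLinearMap ∘ₗ A.toLinearMap)).re ≤
      ‖L‖ ^ 2 * ‖D‖ ^ 2 * ∑ n, ‖L (b n)‖ ^ 2 := by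
    rw [LinearMap.trace_eq_sum_inner _ b, Complex.re_sum, Finset.mul_sum]
    refine Finset.sum_le_sum fun n _ => (le_of_eq ?_).trans (hnorm (b n))
    rw [LinearMap.comp_apply, ← hA.isSymmetric]
    exact inner_self_eq_norm_sq (𝕜 := ℂ) _
  refine (lintegral_congr fun x => by rw [← hinner]; rfl).trans_le
    ((lintegral_exp_inner_stdGaussian_le hA.isSymmetric hbound).trans ?_)
  rw [htrace]
  gcongr

end QuadraticForm

section Orthonormal

variable {𝕜 E ι : Type*} [RCLike 𝕜] [NormedAddCommGroup E] [InnerProductSpace 𝕜 E]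

lemma norm_sq_sum_smul_of_orthonormal [Fintype ι] {e : ι → E} (he : Orthonormal 𝕜 e)
    (c : ι → 𝕜) : ‖∑ i, c i • e i‖ ^ 2 = ∑ i, ‖c i‖ ^ 2 := by
  rw [← inner_self_eq_norm_sq (𝕜 := 𝕜), he.inner_sum, map_sum]
  refine Finset.sum_congr rfl fun i _ => ?_
  rw [RCLike.conj_mul, ← RCLike.ofReal_pow, RCLike.ofReal_re]

lemma countable_of_orthonormal [TopologicalSpace.SeparableSpace E] {e : ι → E}
    (he : Orthonormal 𝕜 e) : Countable ι := by
  have hdist {i j : ι} (hij : i ≠ j) : 1 ≤ dist (e i) (e j) := by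
    have hsq : ‖e i - e j‖ ^ 2 = 2 := by
      rw [norm_sub_sq (𝕜 := 𝕜), he.inner_eq_zero hij, he.norm_eq_one, he.norm_eq_one, map_zero]
      norm_num
    rw [dist_eq_norm]
    nlinarith [norm_nonneg (e i - e j)]
  have hdisj : (Set.univ : Set ι).PairwiseDisjoint fun i => Metric.ball (e i) (1 / 2) :=
    fun i _ j _ hij => Metric.ball_disjoint_ball (by linarith [hdist hij])
  exact Set.countable_univ_iff.1 (hdisj.countable_of_isOpen (fun _ _ => Metric.isOpen_ball)
    fun i _ => ⟨e i, Metric.mem_ball_self (by norm_num)⟩)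

lemma hasSum_norm_sq_inner (b : HilbertBasis ι 𝕜 E) (x : E) :
    HasSum (fun i => ‖inner 𝕜 (b i) x‖ ^ 2) (‖x‖ ^ 2) := by
  have h := (b.hasSum_inner_mul_inner x x).mapL RCLike.reCLM
  simp only [RCLike.reCLM_apply, inner_self_eq_norm_sq] at h
  refine h.congr_fun fun i => ?_
  rw [inner_mul_symm_re_eq_norm, norm_mul, norm_inner_symm, sq]

lemma summable_smul_hilbertBasis (b : HilbertBasis ι 𝕜 E) {c : ι → 𝕜}
    (hc : Summable fun i => ‖c i‖ ^ 2) : Summable fun i => c i • b i := by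
  have hmem : Memℓp c 2 := memℓp_gen (by simpa using hc)
  exact (b.hasSum_repr_symm ⟨c, hmem⟩).summable

lemma norm_sq_tsum_smul_hilbertBasis (b : HilbertBasis ι 𝕜 E) {c : ι → 𝕜}
    (hc : Summable fun i => c i • b i) : ‖∑' i, c i • b i‖ ^ 2 = ∑' i, ‖c i‖ ^ 2 := by
  have hinner (i : ι) : inner 𝕜 (b i) (∑' j, c j • b j) = c i := by
    classical
    rw [← innerSL_apply_apply, ContinuousLinearMap.map_tsum _ hc, tsum_eq_single i]
    · simp [b.orthonormal.norm_eq_one]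
    · intro j hji
      simp [b.orthonormal.inner_eq_zero hji.symm]
  rw [← (hasSum_norm_sq_inner b _).tsum_eq]
  simp_rw [hinner]

end Orthonormal

section OrthonormalSum

variable {𝕜 F E : Type*} [RCLike 𝕜] [Fintype F] [NormedAddCommGroup E] [InnerProductSpace 𝕜 E]

/-- The linear combination `x ↦ ∑ n, (a n * x n) • e n` as an operator on coordinate vectors. With
`a n = √(p n / 2)` it turns a standard Gaussian vector, whose complex coordinates have variance
`2`, into a sum `∑ n, Z n • e n` with `Z n` of variance `p n`. -/
noncomputable def weightedSum (a : F → 𝕜) (e : F → E) : EuclideanSpace 𝕜 F →L[𝕜] E :=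
  ∑ n, (EuclideanSpace.proj n : StrongDual 𝕜 (EuclideanSpace 𝕜 F)).smulRight (a n • e n)

lemma weightedSum_apply (a : F → 𝕜) (e : F → E) (x : EuclideanSpace 𝕜 F) :
    weightedSum a e x = ∑ n, (a n * x n) • e n := by
  simp [weightedSum, smul_smul, mul_comm]

lemma weightedSum_basisFun (a : F → 𝕜) (e : F → E) (n : F) :
    weightedSum a e (EuclideanSpace.basisFun F 𝕜 n) = a n • e n := by
  classical
  simp [weightedSum_apply]

lemma norm_sq_weightedSum_le {a : F → 𝕜} {e : F → E} (he : Orthonormal 𝕜 e) {r : ℝ≥0}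
    (ha : ∀ n, ‖a n‖ ^ 2 ≤ r) : ‖weightedSum a e‖ ^ 2 ≤ r := by
  rw [← Real.le_sqrt (norm_nonneg _) (by positivity)]
  refine (weightedSum a e).opNorm_le_bound (Real.sqrt_nonneg _) fun x => ?_
  rw [← Real.sqrt_sq (norm_nonneg x), ← Real.sqrt_mul (by positivity)]
  refine Real.le_sqrt_of_sq_le ?_
  rw [weightedSum_apply, norm_sq_sum_smul_of_orthonormal he, EuclideanSpace.norm_sq_eq,
    Finset.mul_sum]
  gcongr with n
  rw [norm_mul, mul_pow]
  gcongr
  exact ha n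

variable {H : Type*} [NormedAddCommGroup H] [InnerProductSpace ℂ H] [CompleteSpace H]

lemma lintegral_exp_inner_sum_smul_le {e : F → H} (he : Orthonormal ℂ e) {p : F → ℝ≥0} {r : ℝ≥0}
    (hp : ∀ n, p n ≤ r) {D : H →L[ℂ] H} (hD : IsSelfAdjoint D) (hrD : r * ‖D‖ ≤ 1 / 2) :
    ∫⁻ z, ENNReal.ofReal (Real.exp (inner ℂ (∑ n, z n • e n) (D (∑ n, z n • e n))).re)
        ∂(Measure.pi fun n => complexGaussian (p n)) ≤
      ENNReal.ofReal (Real.exp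
        (∑ n, p n * (inner ℂ (e n) (D (e n))).re + 2 * r * ‖D‖ ^ 2 * ∑ n, (p n : ℝ))) := by
  let a (n : F) : ℂ := (√(p n / 2) : ℝ)
  have ha (n : F) : ‖a n‖ ^ 2 = p n / 2 := by
    rw [Complex.norm_real, Real.norm_of_nonneg (Real.sqrt_nonneg _), Real.sq_sqrt (by positivity)]
  let L : EuclideanSpace ℂ F →L[ℂ] H := weightedSum a e
  have hL : ‖L‖ ^ 2 ≤ r / 2 := by
    refine norm_sq_weightedSum_le (r := r / 2) he fun n => ?_
    rw [ha, NNReal.coe_div, NNReal.coe_ofNat]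
    gcongr
    exact hp n
  have hinner (n : F) : (inner ℂ (a n • e n) (D (a n • e n))).re =
      p n * (inner ℂ (e n) (D (e n))).re / 2 := by
    rw [map_smul, inner_smul_left, inner_smul_right, ← mul_assoc, RCLike.conj_mul,
      mul_div_right_comm, ← ha, ← Complex.re_ofReal_mul, Complex.ofReal_pow]
    rfl
  have hnorm (n : F) : ‖a n • e n‖ ^ 2 = p n / 2 := by
    rw [norm_smul, he.norm_eq_one, mul_one, ha]
  have hmain := lintegral_exp_inner_map_stdGaussian_le L hD
    (calc ‖L‖ ^ 2 * ‖D‖ ≤ r / 2 * ‖D‖ := by gcongr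
      _ ≤ 1 / 4 := by linarith) (EuclideanSpace.basisFun F ℂ)
  simp_rw [L, weightedSum_basisFun, hinner, hnorm, weightedSum_apply, ← Finset.sum_div] at hmain
  have hcont : Continuous fun z : F → ℂ =>
      Real.exp (inner ℂ (∑ n, z n • e n) (D (∑ n, z n • e n))).re := by fun_prop
  rw [pi_complexGaussian_eq_map_stdGaussian,
    lintegral_map hcont.measurable.ennreal_ofReal (by fun_prop)]
  refine hmain.trans (ENNReal.ofReal_le_ofReal (Real.exp_le_exp.2 ?_))
  have hsq : ‖L‖ ^ 2 * (‖D‖ ^ 2 * ∑ n, (p n : ℝ)) ≤ r / 2 * (‖D‖ ^ 2 * ∑ n, (p n : ℝ)) := by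
    gcongr
  linarith

end OrthonormalSum

lemma norm_inner_apply_self_le {𝕜 E : Type*} [RCLike 𝕜] [NormedAddCommGroup E]
    [InnerProductSpace 𝕜 E] (T : E →L[𝕜] E) {x : E} (hx : ‖x‖ = 1) :
    ‖inner 𝕜 x (T x)‖ ≤ ‖T‖ := by
  simpa only [hx, one_mul, mul_one] using
    (norm_inner_le_norm (𝕜 := 𝕜) x (T x)).trans
      (mul_le_mul_of_nonneg_left (T.le_opNorm x) (norm_nonneg _))

section DensityMatrix

variable {H : Type*} [NormedAddCommGroup H] [InnerProductSpace ℂ H] [CompleteSpace H]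
  (ρ : DensityMatrix H)

namespace DensityMatrix

lemma inner_eigenbasis_op (n : ρ.eigenIndex) :
    inner ℂ (ρ.eigenbasis n) (ρ.op (ρ.eigenbasis n)) = ρ.eigenvalue n := by
  rw [ρ.op_eigenbasis, inner_smul_right, inner_self_eq_norm_sq_to_K,
    ρ.eigenbasis.orthonormal.norm_eq_one, RCLike.ofReal_one, one_pow, mul_one]

lemma hasSum_eigenvalue : HasSum (fun n => (ρ.eigenvalue n : ℝ)) 1 := by
  have h := Complex.hasSum_re (ρ.hasSum_trace _ ρ.eigenbasis)
  simp_rw [ρ.inner_eigenbasis_op] at h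
  exact h

lemma eigenvalue_le_nnnorm (n : ρ.eigenIndex) : ρ.eigenvalue n ≤ ‖ρ.op‖₊ := by
  have h := ρ.op.le_opNNNorm (ρ.eigenbasis n)
  rw [ρ.op_eigenbasis, nnnorm_smul, ρ.eigenbasis.orthonormal.nnnorm_eq_one, mul_one,
    mul_one] at h
  simpa using h

lemma norm_op_pos : 0 < ‖ρ.op‖ := by
  by_contra! h
  have hzero (n) : (ρ.eigenvalue n : ℝ) = 0 :=
    le_antisymm ((NNReal.coe_le_coe.2 (ρ.eigenvalue_le_nnnorm n)).trans h) NNReal.zero_le_coe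
  have hsum := ρ.hasSum_eigenvalue
  simp_rw [hzero] at hsum
  exact one_ne_zero (hsum.unique hasSum_zero)

lemma hasSum_smul_rankOne_eigenbasis :
    HasSum (fun n => (ρ.eigenvalue n : ℂ) •
      InnerProductSpace.rankOne ℂ (ρ.eigenbasis n) (ρ.eigenbasis n)) ρ.op := by
  have hsum : Summable fun n => (ρ.eigenvalue n : ℂ) •
      InnerProductSpace.rankOne ℂ (ρ.eigenbasis n) (ρ.eigenbasis n) := by
    refine .of_norm_bounded ρ.hasSum_eigenvalue.summable fun n => ?_
    rw [norm_smul, InnerProductSpace.norm_rankOne, ρ.eigenbasis.orthonormal.norm_eq_one, mul_one,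
      mul_one, Complex.norm_real, NNReal.norm_eq]
  convert hsum.hasSum using 1
  ext x
  refine ((ρ.eigenbasis.hasSum_repr x).mapL ρ.op).unique
    ((hsum.hasSum.mapL (ContinuousLinearMap.apply ℂ H x)).congr_fun fun n => ?_)
  rw [map_smul, ρ.op_eigenbasis, ρ.eigenbasis.repr_apply_apply, smul_comm]
  rfl

lemma norm_eigenvalue_mul_inner_le (T : H →L[ℂ] H) (n : ρ.eigenIndex) :
    ‖(ρ.eigenvalue n : ℂ) * inner ℂ (ρ.eigenbasis n) (T (ρ.eigenbasis n))‖ ≤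
      ρ.eigenvalue n * ‖T‖ := by
  rw [norm_mul, Complex.norm_real, NNReal.norm_eq]
  gcongr
  exact norm_inner_apply_self_le T (ρ.eigenbasis.orthonormal.norm_eq_one n)

lemma summable_eigenvalue_mul_inner (T : H →L[ℂ] H) : Summable fun n =>
    (ρ.eigenvalue n : ℂ) * inner ℂ (ρ.eigenbasis n) (T (ρ.eigenbasis n)) :=
  .of_norm_bounded (ρ.hasSum_eigenvalue.summable.mul_right ‖T‖)
    (ρ.norm_eigenvalue_mul_inner_le T)

/-- The expectation value `tr (ρ T) = ∑ n, p n * ⟨n|T|n⟩` of a bounded operator `T` in the state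
`ρ`, as a bounded linear functional of `T`. -/
noncomputable def expectation : (H →L[ℂ] H) →L[ℂ] ℂ :=
  LinearMap.mkContinuous
    { toFun := fun T =>
        ∑' n, (ρ.eigenvalue n : ℂ) * inner ℂ (ρ.eigenbasis n) (T (ρ.eigenbasis n))
      map_add' := fun S T => by
        rw [← (ρ.summable_eigenvalue_mul_inner S).tsum_add (ρ.summable_eigenvalue_mul_inner T)]
        simp_rw [add_apply, inner_add_right, mul_add]
      map_smul' := fun c T => by
        rw [RingHom.id_apply, ← tsum_const_smul'']
        simp_rw [smul_apply, inner_smul_right, smul_eq_mul, mul_left_comm] }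
    1 fun T => tsum_of_norm_bounded (ρ.hasSum_eigenvalue.mul_right ‖T‖)
      (ρ.norm_eigenvalue_mul_inner_le T)

lemma hasSum_expectation (T : H →L[ℂ] H) : HasSum (fun n => (ρ.eigenvalue n : ℂ) *
    inner ℂ (ρ.eigenbasis n) (T (ρ.eigenbasis n))) (ρ.expectation T) :=
  (ρ.summable_eigenvalue_mul_inner T).hasSum

lemma hasSum_re_expectation (T : H →L[ℂ] H) : HasSum (fun n => ρ.eigenvalue n *
    (inner ℂ (ρ.eigenbasis n) (T (ρ.eigenbasis n))).re) (ρ.expectation T).re := by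
  simpa only [Complex.re_ofReal_mul] using Complex.hasSum_re (ρ.hasSum_expectation T)

lemma abs_re_expectation_le (T : H →L[ℂ] H) : |(ρ.expectation T).re| ≤ ‖T‖ :=
  (Complex.abs_re_le_norm _).trans
    (((ρ.expectation).le_of_opNorm_le (LinearMap.mkContinuous_norm_le _ zero_le_one _) T).trans_eq
      (one_mul _))

lemma expectation_one : ρ.expectation 1 = 1 := by
  refine (ρ.hasSum_expectation 1).unique ?_
  simpa [inner_self_eq_norm_sq_to_K, ρ.eigenbasis.orthonormal.norm_eq_one] using
    Complex.hasSum_ofReal.2 ρ.hasSum_eigenvalue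

end DensityMatrix

end DensityMatrix

section GaussianMeasure

variable {H : Type*} [NormedAddCommGroup H] [InnerProductSpace ℂ H] [CompleteSpace H]
  [TopologicalSpace.SeparableSpace H] (ρ : DensityMatrix H)

/-- The joint law of the independent coefficients `Z n` in `∑ n, Z n • |n⟩`. -/
noncomputable abbrev coefficientMeasure : Measure (ρ.eigenIndex → ℂ) :=
  Measure.infinitePi fun n => complexGaussian (ρ.eigenvalue n)

instance : Countable ρ.eigenIndex := countable_of_orthonormal ρ.eigenbasis.orthonormal

lemma lintegral_tsum_norm_sq_coefficientMeasure :
    ∫⁻ z, ∑' n, ENNReal.ofReal (‖z n‖ ^ 2) ∂(coefficientMeasure ρ) = 1 := by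
  have hterm (n) : ∫⁻ z, ENNReal.ofReal (‖z n‖ ^ 2) ∂(coefficientMeasure ρ) =
      ENNReal.ofReal (ρ.eigenvalue n) := by
    rw [(measurePreserving_eval_infinitePi _ n).lintegral_comp
      (f := fun z => ENNReal.ofReal (‖z‖ ^ 2)) (by fun_prop), lintegral_norm_sq_complexGaussian,
      ENNReal.ofReal_coe_nnreal]
  rw [lintegral_tsum fun n => Measurable.aemeasurable (by fun_prop)]
  simp_rw [hterm]
  rw [← ENNReal.ofReal_tsum_of_nonneg (fun n => NNReal.coe_nonneg _) ρ.hasSum_eigenvalue.summable,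
    ρ.hasSum_eigenvalue.tsum_eq, ENNReal.ofReal_one]

lemma ae_summable_norm_sq_coefficientMeasure :
    ∀ᵐ z ∂(coefficientMeasure ρ), Summable fun n => ‖z n‖ ^ 2 := by
  have h := ae_lt_top (μ := coefficientMeasure ρ)
    (f := fun z => ∑' n, ENNReal.ofReal (‖z n‖ ^ 2)) (by fun_prop)
    (by rw [lintegral_tsum_norm_sq_coefficientMeasure]; exact ENNReal.one_ne_top)
  filter_upwards [h] with z hz
  simpa [ENNReal.toReal_ofReal] using ENNReal.summable_toReal hz.ne

lemma ae_hasSum_coefficientMeasure : ∀ᵐ z ∂(coefficientMeasure ρ),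
    HasSum (fun n => z n • ρ.eigenbasis n) (∑' n, z n • ρ.eigenbasis n) := by
  filter_upwards [ae_summable_norm_sq_coefficientMeasure ρ] with z hz
  exact (summable_smul_hilbertBasis ρ.eigenbasis hz).hasSum

variable [MeasurableSpace H] [BorelSpace H]

lemma aemeasurable_tsum_smul_eigenbasis :
    AEMeasurable (fun z : ρ.eigenIndex → ℂ => ∑' n, z n • ρ.eigenbasis n)
      (coefficientMeasure ρ) := by
  have : SecondCountableTopology H := UniformSpace.secondCountable_of_separable H
  refine aemeasurable_of_tendsto_metrizable_ae Filter.atTop (f := fun F z =>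
    ∑ n ∈ F, z n • ρ.eigenbasis n) (fun F => Measurable.aemeasurable (by fun_prop)) ?_
  filter_upwards [ae_hasSum_coefficientMeasure ρ] with z hz
  simpa [HasSum] using hz

lemma lintegral_norm_sq_gaussianMeasure :
    ∫⁻ ψ, ENNReal.ofReal (‖ψ‖ ^ 2) ∂(gaussianMeasure ρ) = 1 := by
  rw [gaussianMeasure, lintegral_map' (by fun_prop) (aemeasurable_tsum_smul_eigenbasis ρ),
    ← lintegral_tsum_norm_sq_coefficientMeasure ρ]
  refine lintegral_congr_ae ?_
  filter_upwards [ae_summable_norm_sq_coefficientMeasure ρ] with z hz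
  rw [norm_sq_tsum_smul_hilbertBasis _ (summable_smul_hilbertBasis ρ.eigenbasis hz),
    ENNReal.ofReal_tsum_of_nonneg (fun _ => by positivity) hz]

lemma lintegral_gaussianMeasure_le_liminf {f : H → ℝ≥0∞} (hf : Continuous f) :
    ∫⁻ ψ, f ψ ∂(gaussianMeasure ρ) ≤ Filter.liminf (fun F : Finset ρ.eigenIndex =>
      ∫⁻ z, f (∑ n, z n • ρ.eigenbasis n)
        ∂(Measure.pi fun n : F => complexGaussian (ρ.eigenvalue n))) Filter.atTop := by
  have : SecondCountableTopology H := UniformSpace.secondCountable_of_separable H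
  have hlim : ∀ᵐ z ∂(coefficientMeasure ρ), f (∑' n, z n • ρ.eigenbasis n) =
      Filter.liminf (fun F => f (∑ n ∈ F, z n • ρ.eigenbasis n)) Filter.atTop := by
    filter_upwards [ae_hasSum_coefficientMeasure ρ] with z hz
    exact ((hf.tendsto _).comp hz).liminf_eq.symm
  have hrestrict (F : Finset ρ.eigenIndex) :
      ∫⁻ z, f (∑ n ∈ F, z n • ρ.eigenbasis n) ∂(coefficientMeasure ρ) =
        ∫⁻ z, f (∑ n, z n • ρ.eigenbasis n)
          ∂(Measure.pi fun n : F => complexGaussian (ρ.eigenvalue n)) := by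
    have hcont : Continuous fun z : F → ℂ => f (∑ n, z n • ρ.eigenbasis n) :=
      hf.comp (by fun_prop)
    rw [← lintegral_restrict_infinitePi (μ := fun n => complexGaussian (ρ.eigenvalue n))
      hcont.measurable]
    refine lintegral_congr fun z => ?_
    rw [← Finset.sum_coe_sort F]
    rfl
  rw [gaussianMeasure, lintegral_map' hf.aemeasurable (aemeasurable_tsum_smul_eigenbasis ρ),
    lintegral_congr_ae hlim]
  simp_rw [← hrestrict]
  exact lintegral_liminf_le fun F => hf.measurable.comp (by fun_prop)

lemma lintegral_exp_inner_gaussianMeasure_le {D : H →L[ℂ] H} (hD : IsSelfAdjoint D)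
    (hρD : ‖ρ.op‖ * ‖D‖ ≤ 1 / 2) :
    ∫⁻ ψ, ENNReal.ofReal (Real.exp (inner ℂ ψ (D ψ)).re) ∂(gaussianMeasure ρ) ≤
      ENNReal.ofReal (Real.exp ((ρ.expectation D).re + 2 * ‖ρ.op‖ * ‖D‖ ^ 2)) := by
  have hcont : Continuous fun ψ : H => ENNReal.ofReal (Real.exp (inner ℂ ψ (D ψ)).re) :=
    ENNReal.continuous_ofReal.comp (by fun_prop)
  have hfinite (F : Finset ρ.eigenIndex) := lintegral_exp_inner_sum_smul_le
    (ρ.eigenbasis.orthonormal.comp ((↑) : F → ρ.eigenIndex) Subtype.val_injective)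
    (fun n => ρ.eigenvalue_le_nnnorm n) hD hρD
  have hlim : Filter.Tendsto (fun F : Finset ρ.eigenIndex => ENNReal.ofReal (Real.exp
      (∑ n : F, ρ.eigenvalue n * (inner ℂ (ρ.eigenbasis n) (D (ρ.eigenbasis n))).re +
        2 * ‖ρ.op‖₊ * ‖D‖ ^ 2 * ∑ n : F, (ρ.eigenvalue n : ℝ)))) Filter.atTop
      (nhds (ENNReal.ofReal (Real.exp ((ρ.expectation D).re + 2 * ‖ρ.op‖ * ‖D‖ ^ 2)))) := by
    refine ENNReal.tendsto_ofReal ((Real.continuous_exp.tendsto _).comp ?_)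
    have h := (ρ.hasSum_re_expectation D).add
      (ρ.hasSum_eigenvalue.mul_left (2 * ‖ρ.op‖ * ‖D‖ ^ 2))
    rw [mul_one] at h
    refine h.congr fun F => ?_
    rw [Finset.sum_add_distrib, ← Finset.mul_sum, ← Finset.sum_coe_sort F,
      ← Finset.sum_coe_sort F (fun n => (ρ.eigenvalue n : ℝ)), coe_nnnorm]
  exact (lintegral_gaussianMeasure_le_liminf ρ hcont).trans
    ((Filter.liminf_le_liminf (Filter.Eventually.of_forall hfinite)).trans_eq hlim.liminf_eq)

end GaussianMeasure

section Concentration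

section QuadraticForm

variable {H : Type*} [NormedAddCommGroup H] [InnerProductSpace ℂ H]

lemma re_inner_apply_inv_norm_smul (T : H →L[ℂ] H) (ψ : H) :
    (inner ℂ (((‖ψ‖⁻¹ : ℝ) : ℂ) • ψ) (T (((‖ψ‖⁻¹ : ℝ) : ℂ) • ψ))).re =
      (‖ψ‖ ^ 2)⁻¹ * (inner ℂ ψ (T ψ)).re := by
  rw [map_smul, inner_smul_left, inner_smul_right, ← mul_assoc, Complex.conj_ofReal,
    ← Complex.ofReal_mul, Complex.re_ofReal_mul, sq, mul_inv]

lemma re_inner_realPart_apply [CompleteSpace H] (T : H →L[ℂ] H) (ψ : H) :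
    (inner ℂ ψ ((realPart T : H →L[ℂ] H) ψ)).re = (inner ℂ ψ (T ψ)).re := by
  have hadjoint : (inner ℂ ψ (T.adjoint ψ)).re = (inner ℂ ψ (T ψ)).re := by
    rw [ContinuousLinearMap.adjoint_inner_right, ← inner_conj_symm, Complex.conj_re]
  rw [realPart_apply_coe, ContinuousLinearMap.star_eq_adjoint, smul_apply, add_apply,
    inner_smul_right_eq_smul, inner_add_right, Complex.real_smul, Complex.re_ofReal_mul,
    Complex.add_re, hadjoint]
  ring

variable [MeasurableSpace H] [BorelSpace H]

lemma measurable_inv_norm_smul [TopologicalSpace.SeparableSpace H] :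
    Measurable fun ψ : H => ((‖ψ‖⁻¹ : ℝ) : ℂ) • ψ := by
  have : SecondCountableTopology H := UniformSpace.secondCountable_of_separable H
  fun_prop

end QuadraticForm

variable {H : Type*} [NormedAddCommGroup H] [InnerProductSpace ℂ H] [CompleteSpace H]
  (ρ : DensityMatrix H)

lemma DensityMatrix.re_expectation_realPart (T : H →L[ℂ] H) :
    (ρ.expectation (realPart T)).re = (ρ.expectation T).re := by
  refine (ρ.hasSum_re_expectation _).unique ?_
  simp_rw [re_inner_realPart_apply]
  exact ρ.hasSum_re_expectation T

variable [TopologicalSpace.SeparableSpace H] [MeasurableSpace H] [BorelSpace H]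

lemma GAP_preimage_coe {U : Set H} (hU : MeasurableSet U) :
    GAP ρ (Subtype.val ⁻¹' U) =
      ∫⁻ ψ in (fun ψ : H => ((‖ψ‖⁻¹ : ℝ) : ℂ) • ψ) ⁻¹' U, ENNReal.ofReal (‖ψ‖ ^ 2)
        ∂(gaussianMeasure ρ) := by
  have hS : MeasurableSet (Metric.sphere (0 : H) 1) := Metric.isClosed_sphere.measurableSet
  have hSU := measurable_inv_norm_smul (hS.inter hU)
  rw [GAP, (MeasurableEmbedding.subtype_coe hS).comap_apply, Subtype.image_preimage_coe,
    Measure.map_apply measurable_inv_norm_smul (hS.inter hU), gaussianAdjusted,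
    withDensity_apply _ hSU, ← lintegral_indicator hSU,
    ← lintegral_indicator (measurable_inv_norm_smul hU)]
  refine lintegral_congr fun ψ => ?_
  classical
  rcases eq_or_ne ψ 0 with rfl | hψ
  · simp only [Set.indicator_apply, norm_zero, zero_pow two_ne_zero, ENNReal.ofReal_zero, ite_self]
  · have hψS : ((‖ψ‖⁻¹ : ℝ) : ℂ) • ψ ∈ Metric.sphere (0 : H) 1 := by simp [norm_smul, hψ]
    rw [Set.indicator_apply, Set.indicator_apply]
    exact if_congr (and_iff_right hψS) rfl rfl

instance isProbabilityMeasure_GAP : IsProbabilityMeasure (GAP ρ) where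
  measure_univ := by
    rw [← Set.preimage_univ (f := Subtype.val), GAP_preimage_coe ρ .univ, Set.preimage_univ,
      Measure.restrict_univ, lintegral_norm_sq_gaussianMeasure]

lemma GAP_re_inner_nonneg_le {D : H →L[ℂ] H} (hD : IsSelfAdjoint D)
    (hρD : ‖ρ.op‖ * ‖D + 1‖ ≤ 1 / 2) :
    GAP ρ {ψ | 0 ≤ (inner ℂ (ψ : H) (D ψ)).re} ≤
      ENNReal.ofReal (Real.exp ((ρ.expectation D).re + 2 * ‖ρ.op‖ * ‖D + 1‖ ^ 2)) := by
  have hU : MeasurableSet {ψ : H | 0 ≤ (inner ℂ ψ (D ψ)).re} :=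
    (isClosed_le continuous_const (by fun_prop)).measurableSet
  have hdensity (ψ : H) : ((fun ψ : H => ((‖ψ‖⁻¹ : ℝ) : ℂ) • ψ) ⁻¹'
        {ψ | 0 ≤ (inner ℂ ψ (D ψ)).re}).indicator (fun ψ => ENNReal.ofReal (‖ψ‖ ^ 2)) ψ ≤
      ENNReal.ofReal (Real.exp (-1)) *
        ENNReal.ofReal (Real.exp (inner ℂ ψ ((D + 1) ψ)).re) := by
    refine Set.indicator_apply_le' (fun hψ => ?_) fun _ => zero_le
    rw [Set.mem_preimage, Set.mem_ofPred_eq, re_inner_apply_inv_norm_smul] at hψ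
    have hnonneg : 0 ≤ (inner ℂ ψ (D ψ)).re := by
      rcases eq_or_ne ψ 0 with rfl | h0
      · simp
      · exact nonneg_of_mul_nonneg_right hψ (by positivity)
    have hinner : (inner ℂ ψ ((D + 1) ψ)).re = (inner ℂ ψ (D ψ)).re + ‖ψ‖ ^ 2 := by
      rw [add_apply, one_apply_eq_self, inner_add_right, Complex.add_re,
        inner_self_eq_norm_sq_to_K]
      norm_cast
    rw [← ENNReal.ofReal_mul (Real.exp_pos _).le, ← Real.exp_add, hinner]
    refine ENNReal.ofReal_le_ofReal ?_
    have hexp := Real.add_one_le_exp (-1 + ((inner ℂ ψ (D ψ)).re + ‖ψ‖ ^ 2))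
    linarith
  calc GAP ρ {ψ | 0 ≤ (inner ℂ (ψ : H) (D ψ)).re}
    _ ≤ ENNReal.ofReal (Real.exp (-1)) *
        ∫⁻ ψ, ENNReal.ofReal (Real.exp (inner ℂ ψ ((D + 1) ψ)).re) ∂(gaussianMeasure ρ) := by
      rw [← lintegral_const_mul' _ _ ENNReal.ofReal_ne_top]
      refine (GAP_preimage_coe ρ hU).trans_le ?_
      rw [← lintegral_indicator (measurable_inv_norm_smul hU)]
      exact lintegral_mono hdensity
    _ ≤ ENNReal.ofReal (Real.exp (-1)) * ENNReal.ofReal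
        (Real.exp ((ρ.expectation (D + 1)).re + 2 * ‖ρ.op‖ * ‖D + 1‖ ^ 2)) := by
      gcongr
      exact lintegral_exp_inner_gaussianMeasure_le ρ (hD.add (.one _)) hρD
    _ = _ := by
      rw [← ENNReal.ofReal_mul (Real.exp_pos _).le, ← Real.exp_add, map_add,
        ρ.expectation_one, Complex.add_re, Complex.one_re]
      ring_nf

lemma GAP_le_re_inner_sub_le_of_isSelfAdjoint {T : H →L[ℂ] H} (hT : IsSelfAdjoint T)
    (hT1 : ‖T‖ ≤ 1) {s t : ℝ} (hs : 0 ≤ s) (hs2 : s ≤ 2) (ht : 0 ≤ t)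
    (hρt : ‖ρ.op‖ * (4 * t + 1) ≤ 1 / 2) :
    GAP ρ {ψ | s ≤ (inner ℂ (ψ : H) (T ψ)).re - (ρ.expectation T).re} ≤
      ENNReal.ofReal (Real.exp (-(t * s) + 2 * ‖ρ.op‖ * (4 * t + 1) ^ 2)) := by
  set c : ℝ := (ρ.expectation T).re + s with hc
  set D : H →L[ℂ] H := (t : ℂ) • (T - (c : ℂ) • 1) with hD_def
  have hD : IsSelfAdjoint D :=
    .smul (Complex.conj_ofReal t) (hT.sub (.smul (Complex.conj_ofReal c) (.one _)))
  have hinner (ψ : Metric.sphere (0 : H) 1) :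
      (inner ℂ (ψ : H) (D ψ)).re = t * ((inner ℂ (ψ : H) (T ψ)).re - c) := by
    simp [hD_def, inner_self_eq_norm_sq_to_K]
  have hexpectation : (ρ.expectation D).re = -(t * s) := by
    simp [hD_def, hc, ρ.expectation_one]
  have hnorm : ‖D + 1‖ ≤ 4 * t + 1 := by
    have hone : ‖(1 : H →L[ℂ] H)‖ ≤ 1 := ContinuousLinearMap.norm_id_le
    have habs : |c| ≤ 3 := (abs_add_le _ _).trans (by
      linarith [ρ.abs_re_expectation_le T, abs_of_nonneg hs])
    calc ‖D + 1‖ ≤ t * (‖T‖ + |c| * ‖(1 : H →L[ℂ] H)‖) + ‖(1 : H →L[ℂ] H)‖ := by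
          refine (norm_add_le _ _).trans (add_le_add_left ?_ _)
          rw [hD_def, norm_smul, Complex.norm_real, Real.norm_of_nonneg ht]
          gcongr
          refine (norm_sub_le _ _).trans_eq ?_
          rw [norm_smul, Complex.norm_real, Real.norm_eq_abs]
      _ ≤ t * (1 + 3 * 1) + 1 := by gcongr
      _ = 4 * t + 1 := by ring
  calc GAP ρ {ψ | s ≤ (inner ℂ (ψ : H) (T ψ)).re - (ρ.expectation T).re}
    _ ≤ GAP ρ {ψ | 0 ≤ (inner ℂ (ψ : H) (D ψ)).re} := by
      refine measure_mono fun ψ (hψ : s ≤ _) => ?_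
      rw [Set.mem_ofPred_eq, hinner]
      exact mul_nonneg ht (by linarith)
    _ ≤ ENNReal.ofReal (Real.exp ((ρ.expectation D).re + 2 * ‖ρ.op‖ * ‖D + 1‖ ^ 2)) :=
      GAP_re_inner_nonneg_le ρ hD (by grw [hnorm, hρt])
    _ ≤ _ := by
      rw [hexpectation]
      gcongr

lemma GAP_le_re_inner_sub_le {T : H →L[ℂ] H} (hT : ‖T‖ ≤ 1) {s : ℝ} (hs : 0 ≤ s) :
    GAP ρ {ψ | s ≤ (inner ℂ (ψ : H) (T ψ)).re - (ρ.expectation T).re} ≤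
      ENNReal.ofReal (3 * Real.exp (-(s ^ 2 / (256 * ‖ρ.op‖)))) := by
  have hr := ρ.norm_op_pos
  rcases lt_or_ge 2 s with hs2 | hs2
  · refine (measure_mono_null (fun ψ (hψ : s ≤ _) => ?_) measure_empty).trans_le zero_le
    have hinner := (abs_le.1 ((Complex.abs_re_le_norm _).trans
      (norm_inner_apply_self_le T (norm_eq_of_mem_sphere ψ)))).2
    have hexpectation := (abs_le.1 (ρ.abs_re_expectation_le T)).1
    exact absurd hψ (by linarith)
  rcases lt_or_ge (1 / 4) ‖ρ.op‖ with hr4 | hr4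
  · refine prob_le_one.trans (ENNReal.one_le_ofReal.2 ?_)
    have hsr : s ^ 2 / (256 * ‖ρ.op‖) ≤ 1 / 2 := by
      rw [div_le_iff₀ (by positivity)]
      nlinarith
    linarith [Real.add_one_le_exp (-(s ^ 2 / (256 * ‖ρ.op‖)))]
  -- This `t` minimises `-t s + 64 ‖ρ‖ t ^ 2`, where `2 (4 t + 1) ^ 2 ≤ 64 t ^ 2 + 4`.
  obtain ⟨t, ht⟩ : ∃ t, t = s / (128 * ‖ρ.op‖) := ⟨_, rfl⟩
  have hrt : ‖ρ.op‖ * t = s / 128 := by rw [ht]; field_simp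
  have htail := GAP_le_re_inner_sub_le_of_isSelfAdjoint ρ (realPart T).2
    ((realPart.norm_le T).trans hT) hs hs2 (ht ▸ by positivity : 0 ≤ t) (by linarith)
  simp_rw [re_inner_realPart_apply, ρ.re_expectation_realPart] at htail
  refine htail.trans (ENNReal.ofReal_le_ofReal ?_)
  have hexponent : -(t * s) + 2 * ‖ρ.op‖ * (4 * t + 1) ^ 2 ≤
      1 + -(s ^ 2 / (256 * ‖ρ.op‖)) := by
    have hts : s ^ 2 / (256 * ‖ρ.op‖) = t * s / 2 := by rw [ht]; field_simp; ring
    have hrtt : ‖ρ.op‖ * t ^ 2 = t * s / 128 := by linear_combination t * hrt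
    rw [hts]
    nlinarith [mul_nonneg hr.le (sq_nonneg (4 * t - 1))]
  calc Real.exp (-(t * s) + 2 * ‖ρ.op‖ * (4 * t + 1) ^ 2)
    _ ≤ Real.exp (1 + -(s ^ 2 / (256 * ‖ρ.op‖))) := Real.exp_le_exp.2 hexponent
    _ = Real.exp 1 * Real.exp (-(s ^ 2 / (256 * ‖ρ.op‖))) := Real.exp_add _ _
    _ ≤ 3 * Real.exp (-(s ^ 2 / (256 * ‖ρ.op‖))) := by
      gcongr
      exact Real.exp_one_lt_three.le

end Concentration

section TraceNorm

open scoped ZMod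

lemma sum_norm_sq_dft {d : ℕ} [NeZero d] (f : ZMod d → ℂ) :
    ∑ k, ‖𝓕 f k‖ ^ 2 = d * ∑ j, ‖f j‖ ^ 2 := by
  have hconj (k : ZMod d) : starRingEnd ℂ (𝓕 f k) =
      ∑ j, ZMod.stdAddChar (j * k) * starRingEnd ℂ (f j) := by
    simp_rw [ZMod.dft_apply, map_sum, smul_eq_mul, map_mul, AddChar.map_neg_eq_conj,
      Complex.conj_conj]
  have hinversion (j : ZMod d) : ∑ k, ZMod.stdAddChar (j * k) * 𝓕 f k = d * f j := by
    have h := congrFun (ZMod.dft_dft f) (-j)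
    simpa [ZMod.dft_apply (𝓕 f), mul_comm] using h
  have hcomplex : ∑ k, starRingEnd ℂ (𝓕 f k) * 𝓕 f k = d * ∑ j, starRingEnd ℂ (f j) * f j :=
    calc ∑ k, starRingEnd ℂ (𝓕 f k) * 𝓕 f k
      _ = ∑ j, starRingEnd ℂ (f j) * ∑ k, ZMod.stdAddChar (j * k) * 𝓕 f k := by
        simp_rw [hconj, Finset.sum_mul, Finset.mul_sum]
        rw [Finset.sum_comm]
        exact Finset.sum_congr rfl fun j _ => Finset.sum_congr rfl fun k _ => by ring
      _ = d * ∑ j, starRingEnd ℂ (f j) * f j := by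
        simp_rw [hinversion, Finset.mul_sum, mul_left_comm]
  simp_rw [Complex.conj_mul'] at hcomplex
  exact_mod_cast hcomplex

lemma norm_abs_apply {E : Type*} [NormedAddCommGroup E] [InnerProductSpace ℂ E] [CompleteSpace E]
    (T : E →L[ℂ] E) (x : E) : ‖CFC.abs T x‖ = ‖T x‖ := by
  have hinner : inner ℂ (CFC.abs T x) (CFC.abs T x) = inner ℂ (T x) (T x) := by
    rw [← ContinuousLinearMap.adjoint_inner_right, ← ContinuousLinearMap.adjoint_inner_right,
      ← ContinuousLinearMap.star_eq_adjoint, (CFC.abs_nonneg T).star_eq, ← mul_apply_eq_comp,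
      CFC.abs_mul_abs, mul_apply_eq_comp, ContinuousLinearMap.star_eq_adjoint]
  rw [norm_eq_sqrt_re_inner (𝕜 := ℂ), hinner, ← norm_eq_sqrt_re_inner]

variable {E : Type*} [NormedAddCommGroup E] [InnerProductSpace ℂ E]

lemma traceNorm_le_sum_norm [FiniteDimensional ℂ E] {ι : Type*} [Fintype ι]
    (e : OrthonormalBasis ι ℂ E) (M : E →L[ℂ] E) : traceNorm M ≤ ∑ i, ‖M (e i)‖ := by
  have : CompleteSpace E := FiniteDimensional.complete ℂ E
  change (LinearMap.trace ℂ E (CFC.abs M : E →L[ℂ] E)).re ≤ _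
  rw [LinearMap.trace_eq_sum_inner _ e, Complex.re_sum]
  refine Finset.sum_le_sum fun i _ => (Complex.re_le_norm _).trans ?_
  refine (norm_inner_le_norm _ _).trans_eq ?_
  rw [e.norm_eq_one, one_mul]
  exact norm_abs_apply M (e i)

lemma traceNorm_le_sqrt [FiniteDimensional ℂ E] {ι : Type*} [Fintype ι]
    (e : OrthonormalBasis ι ℂ E) (M : E →L[ℂ] E) :
    traceNorm M ≤ √(Fintype.card ι * ∑ i, ‖M (e i)‖ ^ 2) :=
  (traceNorm_le_sum_norm e M).trans (Real.le_sqrt_of_sq_le sq_sum_le_card_mul_sum_sq)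

/-- The discrete Weyl operator `∑ j, χ (-j k) |e j⟩⟨e (j + a)|` of an orthonormal basis indexed by
`ZMod d`. Up to normalisation, these `d ^ 2` contractions form an orthonormal basis of the operators
for the Hilbert-Schmidt inner product. -/
noncomputable def weyl {d : ℕ} [NeZero d] (e : OrthonormalBasis (ZMod d) ℂ E) (a k : ZMod d) :
    E →L[ℂ] E :=
  ∑ j, (ZMod.stdAddChar (-(j * k)) : ℂ) • InnerProductSpace.rankOne ℂ (e j) (e (j + a))

variable {d : ℕ} [NeZero d] (e : OrthonormalBasis (ZMod d) ℂ E)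

lemma inner_weyl_apply (a k j : ZMod d) (x : E) :
    inner ℂ (e j) (weyl e a k x) = ZMod.stdAddChar (-(j * k)) * inner ℂ (e (j + a)) x := by
  simp [weyl, sum_apply, orthonormal_iff_ite.1 e.orthonormal]

lemma norm_weyl_le_one (a k : ZMod d) : ‖weyl e a k‖ ≤ 1 := by
  refine ContinuousLinearMap.opNorm_le_bound _ zero_le_one fun x => ?_
  rw [one_mul, ← sq_le_sq₀ (norm_nonneg _) (norm_nonneg _), ← e.sum_sq_norm_inner_right,
    ← e.sum_sq_norm_inner_right x]
  simp_rw [inner_weyl_apply, norm_mul, AddChar.norm_apply, one_mul]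
  exact (Equiv.sum_comp (Equiv.addRight a) fun j => ‖inner ℂ (e j) x‖ ^ 2).le

lemma trace_weyl_comp (a k : ZMod d) (M : E →L[ℂ] E) :
    LinearMap.trace ℂ E (weyl e a k ∘L M : E →L[ℂ] E) =
      𝓕 (fun j => inner ℂ (e (j + a)) (M (e j))) k := by
  rw [LinearMap.trace_eq_sum_inner _ e, ZMod.dft_apply]
  exact Finset.sum_congr rfl fun j _ => inner_weyl_apply e a k j (M (e j))

lemma sum_norm_sq_trace_weyl_comp (M : E →L[ℂ] E) :
    ∑ a, ∑ k, ‖LinearMap.trace ℂ E (weyl e a k ∘L M : E →L[ℂ] E)‖ ^ 2 =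
      d * ∑ j, ‖M (e j)‖ ^ 2 := by
  simp_rw [trace_weyl_comp, sum_norm_sq_dft, ← Finset.mul_sum]
  rw [Finset.sum_comm]
  congr! 2 with j
  rw [← e.sum_sq_norm_inner_right]
  exact Equiv.sum_comp (Equiv.addLeft j) fun i => ‖inner ℂ (e i) (M (e j))‖ ^ 2

lemma traceNorm_le_of_norm_trace_weyl_comp_le [FiniteDimensional ℂ E] {M : E →L[ℂ] E} {η : ℝ}
    (h : ∀ a k, ‖LinearMap.trace ℂ E (weyl e a k ∘L M : E →L[ℂ] E)‖ ≤ η) :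
    traceNorm M ≤ d * η := by
  have hη : 0 ≤ η := (norm_nonneg _).trans (h 0 0)
  refine (traceNorm_le_sqrt e M).trans (Real.sqrt_le_iff.2 ⟨by positivity, ?_⟩)
  rw [ZMod.card, ← sum_norm_sq_trace_weyl_comp e M]
  calc ∑ a, ∑ k, ‖LinearMap.trace ℂ E (weyl e a k ∘L M : E →L[ℂ] E)‖ ^ 2
    _ ≤ ∑ _a : ZMod d, ∑ _k : ZMod d, η ^ 2 := by
      gcongr with a _ k _
      exact h a k
    _ = (d * η) ^ 2 := by
      simp only [Finset.sum_const, Finset.card_univ, ZMod.card, nsmul_eq_mul]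
      ring

end TraceNorm

section PartialTrace

variable {Ha Hb : Type*} [NormedAddCommGroup Ha] [InnerProductSpace ℂ Ha]
  [FiniteDimensional ℂ Ha] [NormedAddCommGroup Hb] [InnerProductSpace ℂ Hb]

lemma separableSpace_tensorProduct [TopologicalSpace.SeparableSpace Hb] :
    TopologicalSpace.SeparableSpace (Ha ⊗[ℂ] Hb) := by
  let e := stdOrthonormalBasis ℂ Ha
  let g : (Fin (Module.finrank ℂ Ha) → Hb) → Ha ⊗[ℂ] Hb := fun y => ∑ i, e i ⊗ₜ[ℂ] y i
  have hg : Continuous g := continuous_finsetSum _ fun i _ =>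
    (TensorProduct.mkL ℂ Ha Hb (e i)).continuous.comp (continuous_apply i)
  refine DenseRange.separableSpace (f := g) (Function.Surjective.denseRange fun x => ?_) hg
  induction x using TensorProduct.induction_on with
  | zero => exact ⟨0, by simp [g]⟩
  | add x y hx hy =>
    obtain ⟨u, rfl⟩ := hx
    obtain ⟨v, rfl⟩ := hy
    exact ⟨u + v, by simp [g, TensorProduct.tmul_add, Finset.sum_add_distrib]⟩
  | tmul x y =>
    refine ⟨fun i => inner ℂ (e i) x • y, ?_⟩
    simp only [g]
    conv_rhs => rw [← e.sum_repr' x, TensorProduct.sum_tmul]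
    simp only [TensorProduct.tmul_smul, TensorProduct.smul_tmul']

variable [CompleteSpace Hb]

/-- The partial inner product `⟨m|_b : Ha ⊗ Hb → Ha` with a vector `m : Hb`. -/
noncomputable def partialInner (m : Hb) : (Ha ⊗[ℂ] Hb) →L[ℂ] Ha := (tensorRight m).adjoint

lemma partialInner_tmul (m y : Hb) (x : Ha) :
    partialInner m (x ⊗ₜ[ℂ] y) = inner ℂ m y • x := by
  refine ext_inner_left ℂ fun v => ?_
  rw [partialInner, ContinuousLinearMap.adjoint_inner_right, inner_smul_right, mul_comm]
  exact TensorProduct.inner_tmul ..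

lemma hasSum_partialInner_tmul {ι : Type*} (b : HilbertBasis ι ℂ Hb) (ψ : Ha ⊗[ℂ] Hb) :
    HasSum (fun i => partialInner (b i) ψ ⊗ₜ[ℂ] b i) ψ := by
  induction ψ using TensorProduct.induction_on with
  | zero => simp [hasSum_zero]
  | add x y hx hy => simpa [TensorProduct.add_tmul] using hx.add hy
  | tmul x y =>
    have h := (b.hasSum_repr y).mapL (TensorProduct.mkL ℂ Ha Hb x)
    simpa [partialInner_tmul, b.repr_apply_apply, TensorProduct.smul_tmul] using h

lemma hasSum_inner_partialInner {ι : Type*} (b : HilbertBasis ι ℂ Hb) (φ ψ : Ha ⊗[ℂ] Hb) :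
    HasSum (fun i => inner ℂ (partialInner (Ha := Ha) (b i) φ) (partialInner (b i) ψ))
      (inner ℂ φ ψ) :=
  ((hasSum_partialInner_tmul b ψ).mapL (innerSL ℂ φ)).congr_fun fun _ =>
    ContinuousLinearMap.adjoint_inner_left _ _ _

lemma hasSum_norm_sq_partialInner {ι : Type*} (b : HilbertBasis ι ℂ Hb) (ψ : Ha ⊗[ℂ] Hb) :
    HasSum (fun i => ‖partialInner (Ha := Ha) (b i) ψ‖ ^ 2) (‖ψ‖ ^ 2) := by
  have ha (x : Ha) : ‖x‖ ^ 2 = (inner ℂ x x).re := norm_sq_eq_re_inner (𝕜 := ℂ) x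
  have hψ : ‖ψ‖ ^ 2 = (inner ℂ ψ ψ).re := norm_sq_eq_re_inner (𝕜 := ℂ) ψ
  simpa only [ha, hψ] using Complex.hasSum_re (hasSum_inner_partialInner b ψ ψ)

variable (Hb) in
/-- The orthonormal basis of `Hb` over which `partialTrace` sums. -/
noncomputable def partialTraceBasis : HilbertBasis (exists_hilbertBasis ℂ Hb).choose ℂ Hb :=
  (exists_hilbertBasis ℂ Hb).choose_spec.choose

lemma partialTraceBasis_apply (m : (exists_hilbertBasis ℂ Hb).choose) :
    partialTraceBasis Hb m = m :=
  congrFun (exists_hilbertBasis ℂ Hb).choose_spec.choose_spec m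

lemma partialTrace_eq_tsum (M : (Ha ⊗[ℂ] Hb) →L[ℂ] (Ha ⊗[ℂ] Hb)) :
    partialTrace M = ∑' m, partialInner (partialTraceBasis Hb m) ∘L M ∘L
      tensorRight (partialTraceBasis Hb m) := by
  simp_rw [partialTraceBasis_apply]
  rfl

lemma partialInner_comp_rankOne_comp (m : Hb) (ψ : Ha ⊗[ℂ] Hb) :
    partialInner m ∘L InnerProductSpace.rankOne ℂ ψ ψ ∘L tensorRight m =
      InnerProductSpace.rankOne ℂ (partialInner (Ha := Ha) m ψ) (partialInner m ψ) := by
  rw [InnerProductSpace.rankOne_comp, InnerProductSpace.comp_rankOne, partialInner]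

lemma hasSum_norm_rankOne_partialInner (ψ : Ha ⊗[ℂ] Hb) :
    HasSum (fun m => ‖InnerProductSpace.rankOne ℂ
      (partialInner (Ha := Ha) (partialTraceBasis Hb m) ψ)
      (partialInner (Ha := Ha) (partialTraceBasis Hb m) ψ)‖) (‖ψ‖ ^ 2) := by
  simp_rw [InnerProductSpace.norm_rankOne, ← sq]
  exact hasSum_norm_sq_partialInner _ ψ

lemma hasSum_reducedDensity (ψ : Ha ⊗[ℂ] Hb) :
    HasSum (fun m => InnerProductSpace.rankOne ℂ
      (partialInner (Ha := Ha) (partialTraceBasis Hb m) ψ)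
      (partialInner (partialTraceBasis Hb m) ψ)) (reducedDensity ψ) := by
  rw [reducedDensity, partialTrace_eq_tsum]
  simp_rw [partialInner_comp_rankOne_comp]
  exact (hasSum_norm_rankOne_partialInner ψ).summable.of_norm.hasSum

lemma hasSum_partialInner_comp_op_comp (ρ : DensityMatrix (Ha ⊗[ℂ] Hb)) (m : Hb) :
    HasSum (fun n => (ρ.eigenvalue n : ℂ) • InnerProductSpace.rankOne ℂ
        (partialInner (Ha := Ha) m (ρ.eigenbasis n)) (partialInner m (ρ.eigenbasis n)))
      (partialInner m ∘L ρ.op ∘L tensorRight m) := by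
  have h := (ρ.hasSum_smul_rankOne_eigenbasis.mapL
    ((ContinuousLinearMap.compL ℂ Ha (Ha ⊗[ℂ] Hb) (Ha ⊗[ℂ] Hb)).flip (tensorRight m))).mapL
      (ContinuousLinearMap.compL ℂ Ha (Ha ⊗[ℂ] Hb) Ha (partialInner m))
  refine h.congr_fun fun n => ?_
  rw [map_smul, map_smul, ← partialInner_comp_rankOne_comp]
  rfl

lemma hasSum_partialTrace (ρ : DensityMatrix (Ha ⊗[ℂ] Hb)) :
    HasSum (fun n => (ρ.eigenvalue n : ℂ) • reducedDensity (ρ.eigenbasis n))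
      (partialTrace ρ.op) := by
  let f : ρ.eigenIndex × (exists_hilbertBasis ℂ Hb).choose → (Ha →L[ℂ] Ha) := fun a =>
    (ρ.eigenvalue a.1 : ℂ) • InnerProductSpace.rankOne ℂ
      (partialInner (partialTraceBasis Hb a.2) (ρ.eigenbasis a.1))
      (partialInner (partialTraceBasis Hb a.2) (ρ.eigenbasis a.1))
  have hnorm (n) : HasSum (fun m => ‖f (n, m)‖) (ρ.eigenvalue n) := by
    have h := (hasSum_norm_rankOne_partialInner (ρ.eigenbasis n)).mul_left (ρ.eigenvalue n : ℝ)
    rw [ρ.eigenbasis.orthonormal.norm_eq_one, one_pow, mul_one] at h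
    refine h.congr_fun fun m => ?_
    rw [norm_smul, Complex.norm_real, NNReal.norm_eq]
  have hf : Summable f := by
    refine .of_norm ((summable_prod_of_nonneg fun a => norm_nonneg _).2
      ⟨fun n => (hnorm n).summable, ?_⟩)
    simpa only [(hnorm _).tsum_eq] using ρ.hasSum_eigenvalue.summable
  have hrow (n) : HasSum (fun m => f (n, m))
      ((ρ.eigenvalue n : ℂ) • reducedDensity (ρ.eigenbasis n)) :=
    (hasSum_reducedDensity (ρ.eigenbasis n)).const_smul _
  have hcolumn (m) : HasSum (fun n => f (n, m)) (partialInner (partialTraceBasis Hb m) ∘L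
      ρ.op ∘L tensorRight (partialTraceBasis Hb m)) :=
    hasSum_partialInner_comp_op_comp ρ (partialTraceBasis Hb m)
  have hcolumns := ((Equiv.prodComm _ _).hasSum_iff.2 hf.hasSum).prod_fiberwise hcolumn
  rw [partialTrace_eq_tsum, hcolumns.tsum_eq]
  exact hf.hasSum.prod_fiberwise hrow

/-- The linear functional `M ↦ tr (A M)`, which tests an operator `M` against the observable `A`. -/
noncomputable def traceMul (A : Ha →L[ℂ] Ha) : (Ha →L[ℂ] Ha) →L[ℂ] ℂ :=
  LinearMap.toContinuousLinearMap
    { toFun := fun M => LinearMap.trace ℂ Ha (A ∘L M : Ha →L[ℂ] Ha)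
      map_add' := fun M N => by simp
      map_smul' := fun c M => by simp }

lemma traceMul_apply (A M : Ha →L[ℂ] Ha) :
    traceMul A M = LinearMap.trace ℂ Ha (A ∘L M : Ha →L[ℂ] Ha) := rfl

lemma traceMul_smul (c : ℂ) (A M : Ha →L[ℂ] Ha) : traceMul (c • A) M = c * traceMul A M := by
  simp [traceMul_apply]

lemma traceMul_rankOne (A : Ha →L[ℂ] Ha) (u v : Ha) :
    traceMul A (InnerProductSpace.rankOne ℂ u v) = inner ℂ v (A u) := by
  rw [traceMul_apply, InnerProductSpace.comp_rankOne, InnerProductSpace.trace_rankOne]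

lemma traceMul_reducedDensity (A : Ha →L[ℂ] Ha) (ψ : Ha ⊗[ℂ] Hb) :
    traceMul A (reducedDensity ψ) = inner ℂ ψ (A.rTensor Hb ψ) := by
  refine ((hasSum_reducedDensity ψ).mapL (traceMul A)).unique
    (((hasSum_partialInner_tmul (partialTraceBasis Hb) ψ).mapL
      (innerSL ℂ ψ ∘L A.rTensor Hb)).congr_fun fun m => ?_)
  rw [traceMul_rankOne]
  exact ContinuousLinearMap.adjoint_inner_left _ _ _

lemma traceMul_partialTrace (A : Ha →L[ℂ] Ha) (ρ : DensityMatrix (Ha ⊗[ℂ] Hb)) :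
    traceMul A (partialTrace ρ.op) = ρ.expectation (A.rTensor Hb) := by
  refine ((hasSum_partialTrace ρ).mapL (traceMul A)).unique
    ((ρ.hasSum_expectation (A.rTensor Hb)).congr_fun fun n => ?_)
  rw [map_smul, traceMul_reducedDensity, smul_eq_mul]

end PartialTrace

section Typicality

lemma exists_lt_re_I_pow_mul {z : ℂ} {s : ℝ} (hz : √2 * s < ‖z‖) :
    ∃ i : Fin 4, s < (Complex.I ^ (i : ℕ) * z).re := by
  have hmax : s < max |z.re| |z.im| :=
    lt_of_mul_lt_mul_left (hz.trans_le (Complex.norm_le_sqrt_two_mul_max z)) (Real.sqrt_nonneg 2)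
  rcases lt_max_iff.1 hmax with h | h <;> rcases lt_abs.1 h with h | h
  · exact ⟨0, by simpa using h⟩
  · exact ⟨2, by simpa using h⟩
  · exact ⟨3, by simpa [Complex.I_pow_three] using h⟩
  · exact ⟨1, by simpa using h⟩

lemma le_measure_le_of_measure_gt_le {Ω : Type*} [MeasurableSpace Ω] {μ : Measure Ω}
    [IsProbabilityMeasure μ] {X : Ω → ℝ} {K κ : ℝ} (hK : 0 < K) (hκ : 0 < κ)
    (hX : ∀ ε, 0 ≤ ε → μ {ω | ε < X ω} ≤ ENNReal.ofReal (K * Real.exp (-(ε ^ 2 / κ))))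
    {δ : ℝ} (hδ : 0 < δ) :
    ENNReal.ofReal (1 - δ) ≤ μ {ω | X ω ≤ √(κ * Real.log (K / δ))} := by
  have hbound : K * Real.exp (-(√(κ * Real.log (K / δ)) ^ 2 / κ)) ≤ δ := by
    have hlog : Real.log (K / δ) ≤ √(κ * Real.log (K / δ)) ^ 2 / κ := by
      rw [le_div_iff₀ hκ, mul_comm, Real.sq_sqrt']
      exact le_max_left _ _
    calc K * Real.exp (-(√(κ * Real.log (K / δ)) ^ 2 / κ))
      _ ≤ K * Real.exp (-Real.log (K / δ)) := by gcongr
      _ = δ := by rw [Real.exp_neg, Real.exp_log (by positivity)]; field_simp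
  have htail := (hX _ (Real.sqrt_nonneg _)).trans (ENNReal.ofReal_le_ofReal hbound)
  rw [ENNReal.ofReal_sub _ hδ.le, ENNReal.ofReal_one, tsub_le_iff_right,
    ← measure_univ (μ := μ)]
  refine (measure_mono fun ω _ => ?_).trans
    ((measure_union_le _ _).trans (add_le_add_right htail _))
  exact le_or_gt (X ω) _

variable {Ha Hb : Type*} [NormedAddCommGroup Ha] [InnerProductSpace ℂ Ha] [FiniteDimensional ℂ Ha]
  [NormedAddCommGroup Hb] [InnerProductSpace ℂ Hb] [CompleteSpace Hb]

lemma finrank_pos_of_densityMatrix (ρ : DensityMatrix (Ha ⊗[ℂ] Hb)) :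
    0 < Module.finrank ℂ Ha := by
  by_contra! h
  have : Subsingleton Ha := Module.finrank_zero_iff.1 (Nat.le_zero.1 h)
  exact ρ.norm_op_pos.ne' (norm_eq_zero.2 (ContinuousLinearMap.ext fun _ => Subsingleton.elim _ _))

variable [TopologicalSpace.SeparableSpace Hb] [MeasurableSpace (Ha ⊗[ℂ] Hb)]
  [BorelSpace (Ha ⊗[ℂ] Hb)] (ρ : DensityMatrix (Ha ⊗[ℂ] Hb))

lemma GAP_lt_re_traceMul_le {A : Ha →L[ℂ] Ha} (hA : ‖A‖ ≤ 1) {s : ℝ} (hs : 0 ≤ s) :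
    GAP ρ {ψ | s < (traceMul A (reducedDensity (ψ : Ha ⊗[ℂ] Hb) - partialTrace ρ.op)).re} ≤
      ENNReal.ofReal (3 * Real.exp (-(s ^ 2 / (256 * ‖ρ.op‖)))) := by
  have := separableSpace_tensorProduct (Ha := Ha) (Hb := Hb)
  simp_rw [map_sub, Complex.sub_re, traceMul_reducedDensity, traceMul_partialTrace]
  refine le_trans (measure_mono fun ψ hψ => ?_)
    (GAP_le_re_inner_sub_le ρ ((A.norm_rTensor_le (G := Hb)).trans hA) hs)
  rw [Set.mem_ofPred_eq] at hψ ⊢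
  exact hψ.le

lemma GAP_lt_norm_traceMul_le {A : Ha →L[ℂ] Ha} (hA : ‖A‖ ≤ 1) {s : ℝ} (hs : 0 ≤ s) :
    GAP ρ {ψ | s < ‖traceMul A (reducedDensity (ψ : Ha ⊗[ℂ] Hb) - partialTrace ρ.op)‖} ≤
      ENNReal.ofReal (12 * Real.exp (-(s ^ 2 / (512 * ‖ρ.op‖)))) := by
  have hphase (i : Fin 4) : ‖Complex.I ^ (i : ℕ) • A‖ ≤ 1 := by
    rwa [norm_smul, norm_pow, Complex.norm_I, one_pow, one_mul]
  have hsubset : {ψ : Metric.sphere (0 : Ha ⊗[ℂ] Hb) 1 |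
        s < ‖traceMul A (reducedDensity (ψ : Ha ⊗[ℂ] Hb) - partialTrace ρ.op)‖} ⊆
      ⋃ i : Fin 4, {ψ | s / √2 < (traceMul (Complex.I ^ (i : ℕ) • A)
        (reducedDensity (ψ : Ha ⊗[ℂ] Hb) - partialTrace ρ.op)).re} := by
    intro ψ hψ
    simp_rw [traceMul_smul]
    refine Set.mem_iUnion.2 (exists_lt_re_I_pow_mul ?_)
    rwa [mul_div_cancel₀ s (by positivity : √2 ≠ 0)]
  refine (measure_mono hsubset).trans ((measure_iUnion_fintype_le _ _).trans
    ((Finset.sum_le_sum fun i _ =>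
      GAP_lt_re_traceMul_le ρ (hphase i) (by positivity : 0 ≤ s / √2)).trans_eq ?_))
  rw [Finset.sum_const, Finset.card_univ, Fintype.card_fin, ← ENNReal.ofReal_nsmul, nsmul_eq_mul,
    div_pow, Real.sq_sqrt zero_le_two, ← mul_assoc, div_div, ← mul_assoc]
  norm_num

lemma GAP_lt_traceNorm_le {d : ℕ} (hd : Module.finrank ℂ Ha = d) {ε : ℝ} (hε : 0 ≤ ε) :
    GAP ρ {ψ | ε < traceNorm (reducedDensity (ψ : Ha ⊗[ℂ] Hb) - partialTrace ρ.op)} ≤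
      ENNReal.ofReal (12 * (d : ℝ) ^ 2 * Real.exp (-(ε ^ 2 / (512 * d ^ 2 * ‖ρ.op‖)))) := by
  have hd0 : 0 < d := hd ▸ finrank_pos_of_densityMatrix ρ
  have : NeZero d := ⟨hd0.ne'⟩
  let e : OrthonormalBasis (ZMod d) ℂ Ha :=
    (stdOrthonormalBasis ℂ Ha).reindex ((finCongr hd).trans (ZMod.finEquiv d).toEquiv)
  have hsubset : {ψ : Metric.sphere (0 : Ha ⊗[ℂ] Hb) 1 |
        ε < traceNorm (reducedDensity (ψ : Ha ⊗[ℂ] Hb) - partialTrace ρ.op)} ⊆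
      ⋃ a : ZMod d × ZMod d, {ψ | ε / d < ‖traceMul (weyl e a.1 a.2)
        (reducedDensity (ψ : Ha ⊗[ℂ] Hb) - partialTrace ρ.op)‖} := by
    refine fun ψ (hψ : ε < _) => Set.mem_iUnion.2 (by_contra fun h => hψ.not_ge ?_)
    push Not at h
    refine (traceNorm_le_of_norm_trace_weyl_comp_le e fun a k => not_lt.1 (h (a, k))).trans_eq ?_
    field_simp
  refine (measure_mono hsubset).trans ((measure_iUnion_fintype_le _ _).trans
    ((Finset.sum_le_sum fun a _ => GAP_lt_norm_traceMul_le ρ (norm_weyl_le_one e a.1 a.2)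
      (by positivity : 0 ≤ ε / d)).trans_eq ?_))
  rw [Finset.sum_const, Finset.card_univ, Fintype.card_prod, ZMod.card, ← ENNReal.ofReal_nsmul,
    nsmul_eq_mul, div_pow, div_div]
  push_cast
  ring_nf

end Typicality

end GAPTypicality

theorem theorem1 {Ha Hb : Type*}
    [NormedAddCommGroup Ha] [InnerProductSpace ℂ Ha] [FiniteDimensional ℂ Ha]
    [NormedAddCommGroup Hb] [InnerProductSpace ℂ Hb] [CompleteSpace Hb]
    [TopologicalSpace.SeparableSpace Hb]
    [MeasurableSpace (Ha ⊗[ℂ] Hb)] [BorelSpace (Ha ⊗[ℂ] Hb)]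
    (da : ℕ) (hda : Module.finrank ℂ Ha = da)
    (ρ : DensityMatrix (Ha ⊗[ℂ] Hb)) :
    IsProbabilityMeasure (GAP ρ) ∧
    (∀ δ : ℝ, 0 < δ →
      ENNReal.ofReal (1 - δ) ≤
        GAP ρ {ψ | traceNorm (reducedDensity (ψ : Ha ⊗[ℂ] Hb) - partialTrace ρ.op) ≤
          48 * Real.pi * da * √(Real.log (12 * (da : ℝ) ^ 2 / δ) * ‖ρ.op‖)}) ∧
    (∀ ε : ℝ, 0 ≤ ε →
      GAP ρ {ψ | ε < traceNorm (reducedDensity (ψ : Ha ⊗[ℂ] Hb) - partialTrace ρ.op)} ≤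
        ENNReal.ofReal (12 * (da : ℝ) ^ 2 *
          Real.exp (-((1 / (2304 * Real.pi ^ 2)) * ε ^ 2 / ((da : ℝ) ^ 2 * ‖ρ.op‖))))) := by
  have := separableSpace_tensorProduct (Ha := Ha) (Hb := Hb)
  have hr : 0 < ‖ρ.op‖ := ρ.norm_op_pos
  have hd : (0 : ℝ) < da := Nat.cast_pos.2 (hda ▸ finrank_pos_of_densityMatrix ρ)
  have htail (ε : ℝ) (hε : 0 ≤ ε) :
      GAP ρ {ψ | ε < traceNorm (reducedDensity (ψ : Ha ⊗[ℂ] Hb) - partialTrace ρ.op)} ≤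
        ENNReal.ofReal (12 * (da : ℝ) ^ 2 *
          Real.exp (-(ε ^ 2 / ((48 * Real.pi * da) ^ 2 * ‖ρ.op‖)))) := by
    have hconst : 512 ≤ (48 * Real.pi) ^ 2 := by nlinarith [Real.pi_gt_three]
    refine (GAP_lt_traceNorm_le ρ hda hε).trans ?_
    rw [mul_pow _ (da : ℝ)]
    gcongr
  refine ⟨isProbabilityMeasure_GAP ρ, fun δ hδ => ?_, fun ε hε => ?_⟩
  · have h := le_measure_le_of_measure_gt_le (by positivity) (by positivity) htail hδ
    rwa [mul_assoc, Real.sqrt_mul (by positivity), Real.sqrt_sq (by positivity),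
      mul_comm ‖ρ.op‖] at h
  · convert! htail ε hε using 5
    field_simp
    ring
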